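/- Let $R$ be an integer with $|R|\ge 2$ and let $B=\{0,b_1,b_2\}\subset\mathbb Z$ consist of three distinct digits. Let $L\subset\mathbb Z$ be a finite set with $0\in L$, and let $(\alpha_l)_{l\in L}$ be non-zero complex numbers with $\alpha_0=1$. Let $\mu(R,B)$ be the unique Borel probability measure $\mu$ on $\mathbb R$ with $\mu(E)=\frac13\sum_{b\in B}\mu(\tau_b^{-1}(E))$ for all Borel sets $E$, where $\tau_b(x)=R^{-1}(x+b)$, and write $e_\lambda(x)=e^{2\pi i\lambda x}$. Consider the condition (ISO) the matrix $T=\frac1{\sqrt3}\left(e^{2\pi i R^{-1}lb}\,\alpha_l\right)_{l\in L,\,b\in B}$ is an isometry, i.e. $T^*T=I_3$. Then (ISO) holds if and only if there are integers $\alpha\ge1$, $\beta\ge0$, $r$, $q_1$, $q_2$ and $s_l$ ($l\in L\setminus\{0\}$) such that the following four conditions hold: (i) $R=3^\alpha r$, and $r$ is not divisible by $3$; (ii) $b_i=3^\beta q_i$ and $q_i$ is not divisible by $3$ for $i=1,2$, $\beta\le\alpha-1$, and $q_1\not\equiv q_2 \pmod 3$; (iii) for every $l\in L\setminus\{0\}$: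 $l=3^{\alpha-1-\beta}s_l$, $s_l$ is not divisible by $3$, and $r$ divides $q_1s_l$ and $q_2s_l$; (iv) $\displaystyle\sum_{l\in L\setminus\{0\},\ s_l\equiv1\,(\mathrm{mod}\ 3)}|\alpha_l|^2=1$ and $\displaystyle\sum_{l\in L\setminus\{0\},\ s_l\equiv2\,(\mathrm{mod}\ 3)}|\alpha_l|^2=1$. If (i)–(iv) hold and in addition (v) there exist $l_1,l_1',l_2,l_2'\in L\setminus\{0\}$ such that $s_{l_1}\equiv s_{l_1'}\equiv1\pmod3$, $s_{l_2}\equiv s_{l_2'}\equiv2\pmod3$, $l_1\not\equiv l_1'\pmod R$ and $l_2\not\equiv l_2'\pmod R$, then the family $$\Big(\prod_{j=0}^k\alpha_{l_j}\Big)\,e_{l_0+Rl_1+\dots+R^kl_k},\qquad l_0\dots l_k\in\Omega(L),$$ is a Parseval frame for $L^2(\mu(R,B))$, that is, the sum of $|\langle v,f_\omega\rangle|^2$ over all members $f_\omega$, $\omega\in\Omega(L)$, of the family equals $\|v\|^2$ for every $v\in L^2(\mu(R,B))$. Here $\Omega(L)$ is the set consisting of the empty word (whose function is the constant $1$) and of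 all finite words $l_0\dots l_k$ with digits in $L$ and $l_k\ne0$, and the family is indexed by the words, repetitions being counted. -/

import Mathlib

noncomputable section

namespace WeightedFourier

open MeasureTheory

/-! ### The self-affine measure -/

/-- `μ` satisfies the invariance equation of the affine iterated function system
`τ_b(x) = R⁻¹ (x + b)`, `b ∈ B`, with equal weights:
`μ(E) = (1/N) ∑_{b ∈ B} μ(τ_b⁻¹(E))` for all Borel sets `E`, where `N = |B|`. -/
def IsSelfAffine (R : ℤ) (B : Finset ℤ) (μ : ProbabilityMeasure ℝ) : Prop :=
  ∀ E : Set ℝ, MeasurableSet E →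
    (μ : Measure ℝ) E =
      (B.card : ENNReal)⁻¹ *
        ∑ b ∈ B, (μ : Measure ℝ) ((fun x : ℝ => (R : ℝ)⁻¹ * (x + (b : ℝ))) ⁻¹' E)

/-- The self-affine measure `μ(R, B)`: the unique Borel probability measure on `ℝ` satisfying the
invariance equation (existence and uniqueness for `|R| ≥ 2` and `B ≠ ∅` are proved in
`existsUnique_isSelfAffine` below). -/
def selfAffineMeasure (R : ℤ) (B : Finset ℤ) : ProbabilityMeasure ℝ :=
  Classical.epsilon (IsSelfAffine R B)

/-! #### Existence: the law of `∑ R^{-(n+1)} ω_n` with independent uniform digits `ω_n ∈ B` -/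

/-- The uniform distribution on the digit set. -/
def digitLaw (B : Finset ℤ) : Measure B := (B.card : ENNReal)⁻¹ • Measure.count

/-- The point with digits `ω`. -/
def digitSum (R : ℤ) (B : Finset ℤ) (ω : ℕ → B) : ℝ :=
  ∑' n, ((R : ℝ)⁻¹) ^ (n + 1) * ((ω n : ℤ) : ℝ)

/-- Prepending a digit. -/
def consDigit (B : Finset ℤ) (p : B × (ℕ → B)) : ℕ → B
  | 0 => p.1
  | n + 1 => p.2 n

theorem isProbabilityMeasure_digitLaw {B : Finset ℤ} (hB : B.Nonempty) :
    IsProbabilityMeasure (digitLaw B) := by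
  constructor
  have h : (B.card : ENNReal) ≠ 0 := by simpa using hB.ne_empty
  simp only [digitLaw, Measure.smul_apply, smul_eq_mul, Measure.count_univ]
  simp only [ENat.card_eq_coe_fintype_card, Fintype.card_coe, ENat.toENNReal_coe]
  exact ENNReal.inv_mul_cancel h (by simp)

theorem measurable_consDigit (B : Finset ℤ) : Measurable (consDigit B) := by
  refine measurable_pi_lambda _ fun n => ?_
  cases n with
  | zero => exact measurable_fst
  | succ n => exact (measurable_pi_apply n).comp measurable_snd

theorem map_consDigit {B : Finset ℤ} (hB : B.Nonempty) :
    haveI := isProbabilityMeasure_digitLaw hB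
    ((digitLaw B).prod (Measure.infinitePi fun _ : ℕ => digitLaw B)).map (consDigit B) =
      Measure.infinitePi fun _ : ℕ => digitLaw B := by
  have := isProbabilityMeasure_digitLaw hB
  refine Measure.eq_infinitePi _ fun s t ht => ?_
  classical
  obtain ⟨m, hm⟩ : ∃ m, s ⊆ Finset.range (m + 1) :=
    ⟨s.sup id, fun i hi => Finset.mem_range.2 (Nat.lt_succ_of_le (Finset.le_sup (f := id) hi))⟩
  set u : ℕ → Set B := fun i => if i ∈ s then t i else Set.univ with hu
  have hum : ∀ i, MeasurableSet (u i) := fun i => by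
    by_cases h : i ∈ s
    · simpa [hu, h] using ht i
    · simp [hu, h]
  have hset : (s : Set ℕ).pi t = (Finset.range (m + 1) : Set ℕ).pi u := by
    ext x
    simp only [Set.mem_pi, hu]
    constructor
    · intro hx i _
      by_cases h : i ∈ s
      · simpa [h] using hx i h
      · simp [h]
    · intro hx i hi
      have hi' : i ∈ s := hi
      have := hx i (hm hi')
      simpa [hi'] using this
  have hprod : ∏ i ∈ s, digitLaw B (t i) = ∏ i ∈ Finset.range (m + 1), digitLaw B (u i) := by
    rw [← Finset.prod_subset hm]
    · exact Finset.prod_congr rfl fun i hi => by simp [hu, hi]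
    · intro i _ hi
      simp [hu, hi]
  have hpre : consDigit B ⁻¹' ((Finset.range (m + 1) : Set ℕ).pi u) =
      u 0 ×ˢ ((Finset.range m : Set ℕ).pi fun i => u (i + 1)) := by
    ext ⟨b, ω⟩
    simp only [Set.mem_preimage, Set.mem_pi, Set.mem_prod, Finset.coe_range, Set.mem_Iio]
    constructor
    · intro h
      exact ⟨h 0 (Nat.succ_pos m), fun i hi => h (i + 1) (Nat.succ_lt_succ hi)⟩
    · rintro ⟨h0, h1⟩ i hi
      cases i with
      | zero => exact h0
      | succ i => exact h1 i (Nat.lt_of_succ_lt_succ hi)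
  rw [hset, Measure.map_apply (measurable_consDigit B)
    (MeasurableSet.pi (Finset.countable_toSet _) fun i _ => hum i), hpre, Measure.prod_prod,
    Measure.infinitePi_pi _ (fun i _ => hum (i + 1)), hprod, Finset.prod_range_succ', mul_comm]

theorem abs_inv_lt_one {R : ℤ} (hR : 2 ≤ |R|) : |(R : ℝ)⁻¹| < 1 := by
  have h : (2 : ℝ) ≤ |(R : ℝ)| := by exact_mod_cast hR
  rw [abs_inv]
  exact inv_lt_one_of_one_lt₀ (by linarith)

theorem exists_digit_bound {R : ℤ} (hR : 2 ≤ |R|) (B : Finset ℤ) :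
    ∃ v : ℕ → ℝ, Summable v ∧
      ∀ n (b : B), ‖((R : ℝ)⁻¹) ^ (n + 1) * ((b : ℤ) : ℝ)‖ ≤ v n := by
  refine ⟨fun n => |(R : ℝ)⁻¹| ^ (n + 1) * ∑ b ∈ B, |(b : ℝ)|, ?_, fun n b => ?_⟩
  · refine Summable.mul_right _ ?_
    exact (summable_nat_add_iff 1).2 (summable_geometric_of_lt_one (abs_nonneg _) (abs_inv_lt_one hR))
  · rw [norm_mul, norm_pow, Real.norm_eq_abs, Real.norm_eq_abs]
    refine mul_le_mul_of_nonneg_left ?_ (by positivity)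
    exact Finset.single_le_sum (f := fun b : ℤ => |(b : ℝ)|) (fun _ _ => abs_nonneg _) b.2

theorem measurable_digitSum {R : ℤ} (hR : 2 ≤ |R|) (B : Finset ℤ) :
    Measurable (digitSum R B) := by
  obtain ⟨v, hv, hb⟩ := exists_digit_bound hR B
  have : Continuous (digitSum R B) := by
    refine continuous_tsum (fun n => ?_) hv fun n ω => hb n (ω n)
    have h : Continuous fun b : B => ((b : ℤ) : ℝ) := continuous_of_discreteTopology
    exact continuous_const.mul (h.comp (continuous_apply n))
  exact this.measurable

theorem digitSum_consDigit {R : ℤ} (hR : 2 ≤ |R|) (B : Finset ℤ) (b : B) (ω : ℕ → B) :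
    digitSum R B (consDigit B (b, ω)) = (R : ℝ)⁻¹ * (digitSum R B ω + ((b : ℤ) : ℝ)) := by
  obtain ⟨v, hv, hb⟩ := exists_digit_bound hR B
  have hs : Summable fun n => ((R : ℝ)⁻¹) ^ (n + 1) * ((consDigit B (b, ω) n : ℤ) : ℝ) :=
    Summable.of_norm_bounded hv fun n => hb n _
  rw [digitSum, hs.tsum_eq_zero_add, digitSum, mul_add, ← tsum_mul_left, add_comm]
  simp only [consDigit, zero_add, pow_one]
  congr 1
  exact tsum_congr fun n => by ring

theorem exists_isSelfAffine {R : ℤ} (hR : 2 ≤ |R|) {B : Finset ℤ} (hB : B.Nonempty) :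
    ∃ μ : ProbabilityMeasure ℝ, IsSelfAffine R B μ := by
  have := isProbabilityMeasure_digitLaw hB
  have hS := measurable_digitSum hR B
  set P : Measure (ℕ → B) := Measure.infinitePi fun _ : ℕ => digitLaw B with hP
  refine ⟨⟨P.map (digitSum R B), Measure.isProbabilityMeasure_map hS.aemeasurable⟩, fun E hE => ?_⟩
  have hτ : ∀ b : ℤ, Measurable fun x : ℝ => (R : ℝ)⁻¹ * (x + (b : ℝ)) := fun b => by fun_prop
  simp only [ProbabilityMeasure.coe_mk]
  conv_lhs => rw [hP, ← map_consDigit hB, ← hP]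
  rw [Measure.map_apply hS hE, Measure.map_apply (measurable_consDigit B) (hS hE),
    Measure.prod_apply (measurable_consDigit B (hS hE)), digitLaw, lintegral_smul_measure,
    lintegral_count, tsum_fintype, smul_eq_mul, ← Finset.sum_coe_sort B]
  congr 1
  refine Finset.sum_congr rfl fun b _ => ?_
  rw [Measure.map_apply hS (hτ b hE)]
  congr 1
  ext ω
  simp only [Set.mem_preimage, digitSum_consDigit hR]

/-! #### Uniqueness -/

theorem charFun_of_isSelfAffine {R : ℤ} {B : Finset ℤ}
    {μ : ProbabilityMeasure ℝ} (h : IsSelfAffine R B μ) (t : ℝ) :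
    charFun (μ : Measure ℝ) t =
      ((B.card : ℂ)⁻¹ * ∑ b ∈ B, Complex.exp ((t * ((R : ℝ)⁻¹ * b) : ℝ) * Complex.I)) *
        charFun (μ : Measure ℝ) ((R : ℝ)⁻¹ * t) := by
  have hτ : ∀ b : ℤ, Measurable fun x : ℝ => (R : ℝ)⁻¹ * (x + (b : ℝ)) := fun b => by fun_prop
  have hμ : (μ : Measure ℝ) = (B.card : ENNReal)⁻¹ •
      ∑ b ∈ B, (μ : Measure ℝ).map fun x : ℝ => (R : ℝ)⁻¹ * (x + (b : ℝ)) := by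
    ext E hE
    rw [h E hE, Measure.smul_apply, smul_eq_mul, Measure.finsetSum_apply]
    congr 1
    exact Finset.sum_congr rfl fun b _ => (Measure.map_apply (hτ b) hE).symm
  have hint : ∀ b : ℤ, Integrable (fun x : ℝ => Complex.exp (t * x * Complex.I))
      ((μ : Measure ℝ).map fun x : ℝ => (R : ℝ)⁻¹ * (x + (b : ℝ))) := fun b => by
    have : IsProbabilityMeasure
        ((μ : Measure ℝ).map fun x : ℝ => (R : ℝ)⁻¹ * (x + (b : ℝ))) :=
      Measure.isProbabilityMeasure_map (hτ b).aemeasurable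
    refine Integrable.of_bound (C := 1) (by fun_prop) (Filter.Eventually.of_forall fun x => ?_)
    rw [← Complex.ofReal_mul, Complex.norm_exp_ofReal_mul_I]
  conv_lhs => rw [hμ]
  rw [charFun_apply_real, integral_smul_measure, integral_finsetSum_measure fun b _ => hint b,
    mul_assoc, Finset.sum_mul, charFun_apply_real]
  simp only [ENNReal.toReal_inv, ENNReal.toReal_natCast, Complex.real_smul, Complex.ofReal_inv,
    Complex.ofReal_natCast]
  congr 1
  refine Finset.sum_congr rfl fun b _ => ?_
  rw [integral_map (hτ b).aemeasurable (by fun_prop), ← integral_const_mul]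
  refine integral_congr_ae (Filter.Eventually.of_forall fun x => ?_)
  simp only [← Complex.exp_add]
  congr 1
  push_cast
  ring

theorem isSelfAffine_unique {R : ℤ} (hR : 2 ≤ |R|) {B : Finset ℤ} (hB : B.Nonempty)
    {μ ν : ProbabilityMeasure ℝ} (hμ : IsSelfAffine R B μ) (hν : IsSelfAffine R B ν) : μ = ν := by
  suffices key : (μ : Measure ℝ) = (ν : Measure ℝ) from Subtype.ext key
  refine Measure.ext_of_charFun (funext fun t => ?_)
  set d : ℝ → ℝ := fun t => ‖charFun (μ : Measure ℝ) t - charFun (ν : Measure ℝ) t‖ with hd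
  have step : ∀ t, d t ≤ d ((R : ℝ)⁻¹ * t) := fun t => by
    simp only [hd]
    rw [charFun_of_isSelfAffine hμ t, charFun_of_isSelfAffine hν t, ← mul_sub, norm_mul]
    refine mul_le_of_le_one_left (norm_nonneg _) ?_
    rw [norm_mul, norm_inv, Complex.norm_natCast]
    have hc : (0 : ℝ) < B.card := by exact_mod_cast hB.card_pos
    rw [inv_mul_le_iff₀ hc, mul_one]
    refine (norm_sum_le _ _).trans (le_of_eq ?_)
    simp only [Complex.norm_exp_ofReal_mul_I, Finset.sum_const, nsmul_eq_mul, mul_one]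
  have iter : ∀ n : ℕ, d t ≤ d (((R : ℝ)⁻¹) ^ n * t) := fun n => by
    induction n with
    | zero => simp
    | succ n ih => exact ih.trans ((step _).trans (le_of_eq (by rw [pow_succ']; ring_nf)))
  have hlim : Filter.Tendsto (fun n : ℕ => d (((R : ℝ)⁻¹) ^ n * t)) Filter.atTop (nhds 0) := by
    have h1 : Filter.Tendsto (fun n : ℕ => ((R : ℝ)⁻¹) ^ n * t) Filter.atTop (nhds 0) := by
      simpa using (tendsto_pow_atTop_nhds_zero_of_abs_lt_one (abs_inv_lt_one hR)).mul_const t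
    have h2 : Continuous d := (continuous_charFun.sub continuous_charFun).norm
    have h3 : d 0 = 0 := by simp [hd]
    simpa [h3, Function.comp_def] using (h2.tendsto 0).comp h1
  have h0 : d t ≤ 0 := ge_of_tendsto' hlim iter
  exact sub_eq_zero.1 (norm_le_zero_iff.1 h0)

theorem existsUnique_isSelfAffine {R : ℤ} (hR : 2 ≤ |R|) {B : Finset ℤ} (hB : B.Nonempty) :
    ∃! μ : ProbabilityMeasure ℝ, IsSelfAffine R B μ := by
  obtain ⟨μ, hμ⟩ := exists_isSelfAffine hR hB
  exact ⟨μ, hμ, fun ν hν => isSelfAffine_unique hR hB hν hμ⟩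

theorem isSelfAffine_selfAffineMeasure {R : ℤ} (hR : 2 ≤ |R|) {B : Finset ℤ} (hB : B.Nonempty) :
    IsSelfAffine R B (selfAffineMeasure R B) :=
  Classical.epsilon_spec (exists_isSelfAffine hR hB)

/-! ### Weighted exponentials and Parseval frames -/

/-- The exponential `e_t(x) = exp(2πi t x)`. -/
def expFun (t : ℝ) (x : ℝ) : ℂ := Complex.exp (2 * Real.pi * Complex.I * t * x)

theorem memLp_expFun (μ : ProbabilityMeasure ℝ) (t : ℝ) :
    MemLp (expFun t) 2 (μ : Measure ℝ) := by
  refine MemLp.of_bound (C := 1) ?_ (Filter.Eventually.of_forall fun x => ?_)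
  · unfold expFun
    fun_prop
  · have : 2 * Real.pi * Complex.I * t * x = ((2 * Real.pi * t * x : ℝ) : ℂ) * Complex.I := by
      push_cast
      ring
    rw [expFun, this, Complex.norm_exp_ofReal_mul_I]

/-- The exponential `e_t` as an element of `L²(μ)`. -/
def expL2 (μ : ProbabilityMeasure ℝ) (t : ℝ) : Lp ℂ 2 (μ : Measure ℝ) :=
  (memLp_expFun μ t).toLp (expFun t)

/-- A family `e` is a Parseval frame for the Hilbert space `H` if
`∑ i, |⟨v, e i⟩|² = ‖v‖²` for all `v`. -/
def IsParsevalFrame {ι H : Type*} [NormedAddCommGroup H] [InnerProductSpace ℂ H]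
    (e : ι → H) : Prop :=
  ∀ v : H, HasSum (fun i => ‖inner ℂ (e i) v‖ ^ 2) (‖v‖ ^ 2)

/-- `Ω(L)`: the empty word and the finite words `l₀ … l_k` with digits in `L` and `l_k ≠ 0`. -/
def Words (L : Finset ℤ) : Set (List ℤ) :=
  {w | (∀ l ∈ w, l ∈ L) ∧ w.getLast? ≠ some 0}

/-- The frequency `l₀ + R l₁ + ⋯ + R^k l_k` of the word `l₀ … l_k`. -/
def frequency (R : ℤ) (w : List ℤ) : ℤ := ∑ i : Fin w.length, R ^ (i : ℕ) * w.get i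

/-- The weight `α_{l₀} ⋯ α_{l_k}` of the word `l₀ … l_k`. -/
def weight (α : ℤ → ℂ) (w : List ℤ) : ℂ := (w.map α).prod

/-- The family `(∏ α_{l_j}) e_{l₀ + R l₁ + ⋯ + R^k l_k}` in `L²(μ)`, indexed by the words
`l₀ … l_k ∈ Ω(L)`. -/
def weightedExponentials (μ : ProbabilityMeasure ℝ) (R : ℤ) (L : Finset ℤ) (α : ℤ → ℂ)
    (w : Words L) : Lp ℂ 2 (μ : Measure ℝ) :=
  weight α w • expL2 μ (frequency R w : ℝ)

/-! ### The isometry condition and the arithmetic conditions -/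

/-- The matrix `T = (1/√N) (exp(2πi R⁻¹ l b) α_l)`, with rows `l ∈ L` and columns `b ∈ B`. -/
def weightMatrix (R : ℤ) (B L : Finset ℤ) (α : ℤ → ℂ) : Matrix L B ℂ :=
  Matrix.of fun l b =>
    ((Real.sqrt (B.card : ℝ) : ℝ) : ℂ)⁻¹ *
      (Complex.exp (2 * Real.pi * Complex.I * ((R : ℂ)⁻¹ * ((l : ℤ) : ℂ) * ((b : ℤ) : ℂ)))
        * α l)

/-- The matrix `T` is an isometry, `T* T = I_N`. -/
def IsIsometryCondition (R : ℤ) (B L : Finset ℤ) (α : ℤ → ℂ) : Prop :=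
  (weightMatrix R B L α).conjTranspose * weightMatrix R B L α = 1

/-- The four arithmetic conditions for the digits `{0, b₁, b₂}`, with data
`R = 3^a r`, `b_i = 3^β q_i` and `l = 3^(a-1-β) s_l`. -/
structure ThreeDigitConditions (R b₁ b₂ : ℤ) (L : Finset ℤ) (α : ℤ → ℂ)
    (a : ℕ) (r : ℤ) (β : ℕ) (q₁ q₂ : ℤ) (s : ℤ → ℤ) : Prop where
  one_le_a : 1 ≤ a
  R_eq : R = 3 ^ a * r
  not_dvd_r : ¬ (3 : ℤ) ∣ r
  β_le : β ≤ a - 1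
  b₁_eq : b₁ = 3 ^ β * q₁
  b₂_eq : b₂ = 3 ^ β * q₂
  not_dvd_q₁ : ¬ (3 : ℤ) ∣ q₁
  not_dvd_q₂ : ¬ (3 : ℤ) ∣ q₂
  q_incongruent : ¬ q₁ ≡ q₂ [ZMOD 3]
  l_eq : ∀ l ∈ L, l ≠ 0 → l = 3 ^ (a - 1 - β) * s l
  not_dvd_s : ∀ l ∈ L, l ≠ 0 → ¬ (3 : ℤ) ∣ s l
  dvd_q₁_s : ∀ l ∈ L, l ≠ 0 → r ∣ q₁ * s l
  dvd_q₂_s : ∀ l ∈ L, l ≠ 0 → r ∣ q₂ * s l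
  sum_one : ∑ l ∈ L with l ≠ 0 ∧ s l ≡ 1 [ZMOD 3], ‖α l‖ ^ 2 = 1
  sum_two : ∑ l ∈ L with l ≠ 0 ∧ s l ≡ 2 [ZMOD 3], ‖α l‖ ^ 2 = 1

/-- In each of the two classes `s_l ≡ 1` and `s_l ≡ 2 (mod 3)` of `L ∖ {0}` there are two elements
that are incongruent modulo `R`. -/
def HasIncongruentPairs (R : ℤ) (L : Finset ℤ) (s : ℤ → ℤ) : Prop :=
  ∃ l₁ ∈ L, ∃ l₁' ∈ L, ∃ l₂ ∈ L, ∃ l₂' ∈ L,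
    l₁ ≠ 0 ∧ l₁' ≠ 0 ∧ l₂ ≠ 0 ∧ l₂' ≠ 0 ∧
    s l₁ ≡ 1 [ZMOD 3] ∧ s l₁' ≡ 1 [ZMOD 3] ∧ s l₂ ≡ 2 [ZMOD 3] ∧ s l₂' ≡ 2 [ZMOD 3] ∧
    ¬ l₁ ≡ l₁' [ZMOD R] ∧ ¬ l₂ ≡ l₂' [ZMOD R]

end WeightedFourier

end

open MeasureTheory

namespace WeightedFourier

section

/-! ### The invariance equation for integrals -/

/-- The branch `τ_b(x) = R⁻¹ (x + b)` of the iterated function system. -/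
noncomputable def branch (R b : ℤ) (x : ℝ) : ℝ := (R : ℝ)⁻¹ * (x + (b : ℝ))

theorem measurable_branch (R b : ℤ) : Measurable (branch R b) := by
  unfold branch
  fun_prop

variable {R : ℤ} {B : Finset ℤ} {μ : ProbabilityMeasure ℝ}

theorem IsSelfAffine.eq_smul_sum_map (h : IsSelfAffine R B μ) :
    (μ : Measure ℝ) =
      (B.card : ENNReal)⁻¹ • ∑ b ∈ B, (μ : Measure ℝ).map (branch R b) := by
  ext E hE
  rw [h E hE, Measure.smul_apply, smul_eq_mul, Measure.finsetSum_apply]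
  congr 1
  exact Finset.sum_congr rfl fun b _ => (Measure.map_apply (measurable_branch R b) hE).symm

theorem IsSelfAffine.map_branch_le (h : IsSelfAffine R B μ) {b : ℤ} (hb : b ∈ B) :
    (μ : Measure ℝ).map (branch R b) ≤ (B.card : ENNReal) • (μ : Measure ℝ) := by
  have hc : (B.card : ENNReal) ≠ 0 := by
    simpa using Finset.ne_empty_of_mem hb
  have key : (B.card : ENNReal) • (μ : Measure ℝ) =
      ∑ b ∈ B, (μ : Measure ℝ).map (branch R b) := by
    conv_lhs => rw [h.eq_smul_sum_map]
    rw [smul_smul, ENNReal.mul_inv_cancel hc (by simp), one_smul]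
  rw [key]
  refine Measure.le_iff.2 fun s _ => ?_
  rw [Measure.finsetSum_apply]
  exact Finset.single_le_sum (f := fun b => (μ : Measure ℝ).map (branch R b) s)
    (fun _ _ => zero_le) hb

theorem IsSelfAffine.memLp_comp_branch (h : IsSelfAffine R B μ) {b : ℤ} (hb : b ∈ B)
    {p : ENNReal} {v : ℝ → ℂ} (hv : MemLp v p (μ : Measure ℝ)) :
    MemLp (fun x => v (branch R b x)) p (μ : Measure ℝ) :=
  (hv.of_measure_le_smul (by simp) (h.map_branch_le hb)).comp_of_map
    (measurable_branch R b).aemeasurable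

theorem IsSelfAffine.integral_eq {F : Type*} [NormedAddCommGroup F] [NormedSpace ℝ F]
    (h : IsSelfAffine R B μ) {f : ℝ → F} (hf : Integrable f (μ : Measure ℝ)) :
    ∫ x, f x ∂(μ : Measure ℝ) =
      (B.card : ℝ)⁻¹ • ∑ b ∈ B, ∫ x, f (branch R b x) ∂(μ : Measure ℝ) := by
  have hi : ∀ b ∈ B, Integrable f ((μ : Measure ℝ).map (branch R b)) := fun b hb =>
    hf.of_measure_le_smul (by simp) (h.map_branch_le hb)
  conv_lhs => rw [h.eq_smul_sum_map]
  rw [integral_smul_measure, integral_finsetSum_measure hi]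
  simp only [ENNReal.toReal_inv, ENNReal.toReal_natCast]
  congr 1
  exact Finset.sum_congr rfl fun b hb =>
    integral_map (measurable_branch R b).aemeasurable (hi b hb).aestronglyMeasurable

theorem IsSelfAffine.integrable_comp_branch {F : Type*} [NormedAddCommGroup F]
    (h : IsSelfAffine R B μ) {b : ℤ} (hb : b ∈ B) {f : ℝ → F}
    (hf : Integrable f (μ : Measure ℝ)) :
    Integrable (fun x => f (branch R b x)) (μ : Measure ℝ) :=
  (hf.of_measure_le_smul (by simp) (h.map_branch_le hb)).comp_measurable (measurable_branch R b)

theorem IsSelfAffine.integral_eq_integral_sum (h : IsSelfAffine R B μ)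
    {F : Type*} [NormedAddCommGroup F] [NormedSpace ℝ F] {f : ℝ → F}
    (hf : Integrable f (μ : Measure ℝ)) :
    ∫ x, f x ∂(μ : Measure ℝ) =
      ∫ x, (B.card : ℝ)⁻¹ • ∑ b ∈ B, f (branch R b x) ∂(μ : Measure ℝ) := by
  rw [integral_smul, integral_finsetSum B fun b hb => h.integrable_comp_branch hb hf,
    ← h.integral_eq hf]

/-! ### The support is bounded -/

theorem IsSelfAffine.exists_ae_abs_le (hR : 2 ≤ |R|) (h : IsSelfAffine R B μ) :
    ∃ M : ℝ, ∀ᵐ x ∂(μ : Measure ℝ), |x| ≤ M := by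
  set D : ℝ := ∑ b ∈ B, |(b : ℝ)| with hD
  have hbD : ∀ b ∈ B, |(b : ℝ)| ≤ D := fun b hb =>
    Finset.single_le_sum (f := fun b : ℤ => |(b : ℝ)|) (fun _ _ => abs_nonneg _) hb
  have hR2 : (2 : ℝ) ≤ |(R : ℝ)| := by exact_mod_cast hR
  set E : ℝ → Set ℝ := fun r => {x | r < |x|} with hE
  have hEm : ∀ r, MeasurableSet (E r) := fun r => measurableSet_lt measurable_const (by fun_prop)
  have step : ∀ s : ℝ, 0 ≤ s → (μ : Measure ℝ) (E (D + s)) ≤ (μ : Measure ℝ) (E (D + 2 * s)) := by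
    intro s hs
    have hD0 : 0 ≤ D := Finset.sum_nonneg fun _ _ => abs_nonneg _
    rw [h _ (hEm _)]
    have hle : ∀ b ∈ B, (μ : Measure ℝ) ((fun x : ℝ => (R : ℝ)⁻¹ * (x + (b : ℝ))) ⁻¹' E (D + s)) ≤
        (μ : Measure ℝ) (E (D + 2 * s)) := by
      intro b hb
      refine measure_mono fun x hx => ?_
      have hx' : D + s < |(R : ℝ)⁻¹ * (x + b)| := hx
      rw [abs_mul, abs_inv, lt_inv_mul_iff₀ (by linarith)] at hx'
      have h1 := abs_add_le x (b : ℝ)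
      have h2 := hbD b hb
      have h3 : 2 * (D + s) ≤ |(R : ℝ)| * (D + s) := by gcongr
      show D + 2 * s < |x|
      linarith
    calc _ ≤ (B.card : ENNReal)⁻¹ * ∑ b ∈ B, (μ : Measure ℝ) (E (D + 2 * s)) := by
          exact mul_le_mul' le_rfl (Finset.sum_le_sum hle)
      _ ≤ _ := by
          rw [Finset.sum_const, nsmul_eq_mul, ← mul_assoc]
          exact mul_le_of_le_one_left zero_le (ENNReal.inv_mul_le_one _)
  have iter : ∀ n : ℕ, (μ : Measure ℝ) (E (D + 1)) ≤ (μ : Measure ℝ) (E (D + 2 ^ n)) := by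
    intro n
    induction n with
    | zero => simp
    | succ n ih => exact ih.trans (by rw [pow_succ']; exact step _ (by positivity))
  have hlim : Filter.Tendsto (fun n : ℕ => (μ : Measure ℝ) (E (D + 2 ^ n))) Filter.atTop
      (nhds ((μ : Measure ℝ) (⋂ n : ℕ, E (D + 2 ^ n)))) := by
    refine tendsto_measure_iInter_atTop (fun n => (hEm _).nullMeasurableSet) ?_
      ⟨0, measure_ne_top _ _⟩
    intro m n hmn x hx
    have hx' : D + 2 ^ n < |x| := hx
    have : (2 : ℝ) ^ m ≤ 2 ^ n := pow_le_pow_right₀ (by norm_num) hmn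
    show D + 2 ^ m < |x|
    linarith
  have hempty : ⋂ n : ℕ, E (D + 2 ^ n) = ∅ := by
    refine Set.eq_empty_of_forall_notMem fun x hx => ?_
    obtain ⟨n, hn⟩ := pow_unbounded_of_one_lt (|x| - D) (one_lt_two (α := ℝ))
    have : D + 2 ^ n < |x| := Set.mem_iInter.1 hx n
    linarith
  rw [hempty, measure_empty] at hlim
  have h0 : (μ : Measure ℝ) (E (D + 1)) = 0 := le_antisymm (ge_of_tendsto' hlim iter) zero_le
  refine ⟨D + 1, ?_⟩
  filter_upwards [measure_eq_zero_iff_ae_notMem.1 h0] with x hx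
  exact not_lt.1 hx

/-! ### The transfer operators -/

theorem continuous_expFun (t : ℝ) : Continuous (expFun t) := by
  unfold expFun
  fun_prop

theorem norm_expFun (t x : ℝ) : ‖expFun t x‖ = 1 := by
  have : 2 * Real.pi * Complex.I * t * x = ((2 * Real.pi * t * x : ℝ) : ℂ) * Complex.I := by
    push_cast
    ring
  rw [expFun, this, Complex.norm_exp_ofReal_mul_I]

theorem expFun_zero (x : ℝ) : expFun 0 x = 1 := by simp [expFun]

theorem conj_expFun (t x : ℝ) : starRingEnd ℂ (expFun t x) = expFun (-t) x := by
  rw [expFun, expFun, ← Complex.exp_conj]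
  congr 1
  simp only [map_mul, map_ofNat, Complex.conj_ofReal, Complex.conj_I, Complex.ofReal_neg]
  ring

theorem expFun_add_left (s t x : ℝ) : expFun (s + t) x = expFun s x * expFun t x := by
  rw [expFun, expFun, expFun, ← Complex.exp_add]
  congr 1
  push_cast
  ring

theorem expFun_add_right (t x y : ℝ) : expFun t (x + y) = expFun t x * expFun t y := by
  rw [expFun, expFun, expFun, ← Complex.exp_add]
  congr 1
  push_cast
  ring

theorem expFun_intCast (m n : ℤ) : expFun (m : ℝ) (n : ℝ) = 1 := by
  rw [expFun, Complex.exp_eq_one_iff]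
  refine ⟨m * n, ?_⟩
  push_cast
  ring

theorem expFun_branch {R : ℤ} (t : ℝ) (b : ℤ) (x : ℝ) :
    expFun t (branch R b x) = expFun (t / R) b * expFun (t / R) x := by
  rw [expFun, expFun, expFun, ← Complex.exp_add, branch]
  congr 1
  push_cast
  ring

/-- The operator dual to prepending the digit `l` to a word of weighted exponentials:
`(S_l v)(x) = N⁻¹ ∑_b conj (α_l e_l(τ_b x)) v(τ_b x)`. -/
noncomputable def transfer (R : ℤ) (B : Finset ℤ) (α : ℤ → ℂ) (l : ℤ) (v : ℝ → ℂ) (x : ℝ) : ℂ :=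
  (B.card : ℂ)⁻¹ * ∑ b ∈ B,
    starRingEnd ℂ (α l) * expFun (-l) (branch R b x) * v (branch R b x)

/-- The inner product of `v` with the weighted exponential of the word `w`. -/
noncomputable def frameCoeff (μ : ProbabilityMeasure ℝ) (R : ℤ) (α : ℤ → ℂ) (w : List ℤ)
    (v : ℝ → ℂ) : ℂ :=
  ∫ x, starRingEnd ℂ (weight α w) * expFun (-(frequency R w : ℝ)) x * v x ∂(μ : Measure ℝ)

theorem frequency_nil (R : ℤ) : frequency R [] = 0 := by simp [frequency]

theorem frequency_cons (R l : ℤ) (w : List ℤ) :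
    frequency R (l :: w) = l + R * frequency R w := by
  have h : frequency R (l :: w) = ∑ i : Fin (w.length + 1), R ^ (i : ℕ) * (l :: w).get i := rfl
  rw [h, Fin.sum_univ_succ, frequency, Finset.mul_sum]
  simp [pow_succ', mul_assoc]

theorem weight_nil (α : ℤ → ℂ) : weight α [] = 1 := rfl

theorem weight_cons (α : ℤ → ℂ) (l : ℤ) (w : List ℤ) : weight α (l :: w) = α l * weight α w := by
  simp [weight]

theorem frameCoeff_nil (α : ℤ → ℂ) (v : ℝ → ℂ) :
    frameCoeff μ R α [] v = ∫ x, v x ∂(μ : Measure ℝ) := by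
  simp [frameCoeff, frequency_nil, weight_nil, expFun_zero]

theorem MemLp.const_mul_expFun_mul (c : ℂ) (t : ℝ) {p : ENNReal} {v : ℝ → ℂ}
    (hv : MemLp v p (μ : Measure ℝ)) :
    MemLp (fun x => c * expFun t x * v x) p (μ : Measure ℝ) := by
  refine MemLp.of_le_mul (c := ‖c‖) hv ?_ (Filter.Eventually.of_forall fun x => ?_)
  · exact ((continuous_const.mul (continuous_expFun t)).aestronglyMeasurable).mul
      hv.aestronglyMeasurable
  · rw [norm_mul, norm_mul, norm_expFun, mul_one]

theorem IsSelfAffine.memLp_transfer (h : IsSelfAffine R B μ) (α : ℤ → ℂ) (l : ℤ)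
    {p : ENNReal} {v : ℝ → ℂ} (hv : MemLp v p (μ : Measure ℝ)) :
    MemLp (transfer R B α l v) p (μ : Measure ℝ) := by
  unfold transfer
  refine MemLp.const_mul (memLp_finsetSum B (f := fun b x => starRingEnd ℂ (α l) *
    expFun (-l) (branch R b x) * v (branch R b x)) fun b hb => ?_) _
  exact h.memLp_comp_branch hb (MemLp.const_mul_expFun_mul (starRingEnd ℂ (α l)) (-l) hv)

theorem IsSelfAffine.frameCoeff_cons (h : IsSelfAffine R B μ) (hR : R ≠ 0) (α : ℤ → ℂ) (l : ℤ)
    (w : List ℤ) {v : ℝ → ℂ} (hv : Integrable v (μ : Measure ℝ)) :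
    frameCoeff μ R α (l :: w) v = frameCoeff μ R α w (transfer R B α l v) := by
  have hR' : (R : ℝ) ≠ 0 := by exact_mod_cast hR
  have hi : Integrable (fun x => starRingEnd ℂ (weight α (l :: w)) *
      expFun (-(frequency R (l :: w) : ℝ)) x * v x) (μ : Measure ℝ) :=
    memLp_one_iff_integrable.1
      (MemLp.const_mul_expFun_mul _ _ (memLp_one_iff_integrable.2 hv))
  rw [frameCoeff, h.integral_eq_integral_sum hi, frameCoeff]
  refine integral_congr_ae (Filter.Eventually.of_forall fun x => ?_)
  simp only [transfer, Complex.real_smul, Complex.ofReal_inv, Complex.ofReal_natCast]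
  simp only [Finset.mul_sum]
  refine Finset.sum_congr rfl fun b _ => ?_
  have h1 : expFun (-(frequency R (l :: w) : ℝ)) (branch R b x) =
      expFun (-(l : ℝ)) (branch R b x) * expFun (-(frequency R w : ℝ)) x := by
    have e : (-(frequency R (l :: w) : ℝ)) = -(l : ℝ) + ((-(R * frequency R w) : ℤ) : ℝ) := by
      rw [frequency_cons]
      push_cast
      ring
    rw [e, expFun_add_left, expFun_branch (R := R) ((-(R * frequency R w) : ℤ) : ℝ)]
    have e2 : ((-(R * frequency R w) : ℤ) : ℝ) / R = ((-frequency R w : ℤ) : ℝ) := by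
      push_cast
      field_simp
    rw [e2, expFun_intCast, one_mul]
    push_cast
    ring
  rw [h1, weight_cons, map_mul]
  ring

theorem IsSelfAffine.integral_transfer_zero (h : IsSelfAffine R B μ) {α : ℤ → ℂ} (hα : α 0 = 1)
    {v : ℝ → ℂ} (hv : Integrable v (μ : Measure ℝ)) :
    ∫ x, transfer R B α 0 v x ∂(μ : Measure ℝ) = ∫ x, v x ∂(μ : Measure ℝ) := by
  rw [h.integral_eq_integral_sum hv]
  refine integral_congr_ae (Filter.Eventually.of_forall fun x => ?_)
  simp [transfer, hα, expFun_zero]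

/-! ### The isometry condition -/

/-- The isometry condition, evaluated on the vector `u`. -/
theorem IsIsometryCondition.sum_norm_sq {L : Finset ℤ} {α : ℤ → ℂ}
    (h : IsIsometryCondition R B L α) (u : ℤ → ℂ) :
    ∑ l ∈ L, ‖∑ b ∈ B, expFun ((l : ℝ) / R) b * α l * u b‖ ^ 2 =
      B.card * ∑ b ∈ B, ‖u b‖ ^ 2 := by
  rcases B.eq_empty_or_nonempty with rfl | hB
  · simp
  have hc : (0 : ℝ) < B.card := by exact_mod_cast hB.card_pos
  set T := weightMatrix R B L α with hT
  set x : B → ℂ := fun b => u b with hx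
  have h1 : star (T.mulVec x) ⬝ᵥ T.mulVec x = star x ⬝ᵥ x := by
    rw [Matrix.star_mulVec, Matrix.dotProduct_mulVec, Matrix.vecMul_vecMul, h, Matrix.vecMul_one]
  have h2 : ∀ {ι : Type} [Fintype ι] (y : ι → ℂ),
      star y ⬝ᵥ y = ((∑ i, ‖y i‖ ^ 2 : ℝ) : ℂ) := by
    intro ι _ y
    simp [dotProduct, Complex.conj_mul']
  rw [h2, h2] at h1
  have h3 := Complex.ofReal_injective h1
  have h4 : ∀ l : L, T.mulVec x l = ((Real.sqrt (B.card : ℝ) : ℝ) : ℂ)⁻¹ *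
      ∑ b ∈ B, expFun ((l : ℝ) / R) b * α l * u b := by
    intro l
    rw [← Finset.sum_coe_sort B, Finset.mul_sum, Matrix.mulVec, dotProduct]
    refine Finset.sum_congr rfl fun b _ => ?_
    simp only [hT, weightMatrix, Matrix.of_apply, hx, expFun]
    have : 2 * Real.pi * Complex.I * ((R : ℂ)⁻¹ * ((l : ℤ) : ℂ) * ((b : ℤ) : ℂ)) =
        2 * Real.pi * Complex.I * (((l : ℤ) / R : ℝ) : ℂ) * (((b : ℤ) : ℝ) : ℂ) := by
      push_cast
      ring
    rw [this]
    ring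
  rw [← Finset.sum_coe_sort L, ← Finset.sum_coe_sort B, ← h3, Finset.mul_sum]
  refine Finset.sum_congr rfl fun l _ => ?_
  rw [h4, norm_mul, mul_pow, norm_inv, Complex.norm_real, Real.norm_eq_abs, inv_pow, sq_abs,
    Real.sq_sqrt hc.le, ← mul_assoc, mul_inv_cancel₀ hc.ne', one_mul]

theorem sum_norm_sq_transfer {L : Finset ℤ} {α : ℤ → ℂ}
    (h : IsIsometryCondition R B L α) (v : ℝ → ℂ) (x : ℝ) :
    ∑ l ∈ L, ‖transfer R B α l v x‖ ^ 2 =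
      (B.card : ℝ)⁻¹ * ∑ b ∈ B, ‖v (branch R b x)‖ ^ 2 := by
  rcases B.eq_empty_or_nonempty with rfl | hB
  · simp [transfer]
  have hc : (B.card : ℝ) ≠ 0 := by exact_mod_cast hB.card_pos.ne'
  have h1 := h.sum_norm_sq fun b => starRingEnd ℂ (v (branch R b x))
  simp only [RCLike.norm_conj] at h1
  have h2 : ∀ l ∈ L, ‖transfer R B α l v x‖ ^ 2 = ((B.card : ℝ)⁻¹) ^ 2 *
      ‖∑ b ∈ B, expFun ((l : ℝ) / R) b * α l * starRingEnd ℂ (v (branch R b x))‖ ^ 2 := by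
    intro l _
    rw [transfer, norm_mul, norm_inv, Complex.norm_natCast, mul_pow]
    congr 2
    have : ∑ b ∈ B, starRingEnd ℂ (α l) * expFun (-l) (branch R b x) * v (branch R b x) =
        expFun (-l / R) x * starRingEnd ℂ
          (∑ b ∈ B, expFun ((l : ℝ) / R) b * α l * starRingEnd ℂ (v (branch R b x))) := by
      rw [map_sum, Finset.mul_sum]
      refine Finset.sum_congr rfl fun b _ => ?_
      rw [expFun_branch, map_mul, map_mul, Complex.conj_conj, conj_expFun, neg_div]
      ring
    rw [this, norm_mul, norm_expFun, one_mul, RCLike.norm_conj]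
  rw [Finset.sum_congr rfl h2, ← Finset.mul_sum, h1]
  field_simp

theorem IsSelfAffine.sum_integral_norm_sq_transfer (h : IsSelfAffine R B μ) {L : Finset ℤ}
    {α : ℤ → ℂ} (hT : IsIsometryCondition R B L α) {v : ℝ → ℂ} (hv : MemLp v 2 (μ : Measure ℝ)) :
    ∑ l ∈ L, ∫ x, ‖transfer R B α l v x‖ ^ 2 ∂(μ : Measure ℝ) =
      ∫ x, ‖v x‖ ^ 2 ∂(μ : Measure ℝ) := by
  have hi : Integrable (fun x => ‖v x‖ ^ 2) (μ : Measure ℝ) := hv.integrable_norm_pow two_ne_zero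
  rw [← integral_finsetSum L fun l _ => (h.memLp_transfer α l hv).integrable_norm_pow two_ne_zero,
    h.integral_eq_integral_sum hi]
  exact integral_congr_ae (Filter.Eventually.of_forall fun x => sum_norm_sq_transfer hT v x)

end

section

/-! ### Words and the Bessel inequality -/

/-- Prepend a digit to a word of `Ω(L)`, identifying the one-letter word `0` with the empty
word. -/
def consWord (p : ℤ × List ℤ) : List ℤ := if p.1 = 0 ∧ p.2 = [] then [] else p.1 :: p.2

theorem consWord_injective : Function.Injective consWord := by
  rintro ⟨l, w⟩ ⟨l', w'⟩ h
  simp only [consWord] at h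
  split_ifs at h with h1 h2 h2
  · exact Prod.ext (h1.1.trans h2.1.symm) (h1.2.trans h2.2.symm)
  · exact Prod.ext (List.cons.inj h).1 (List.cons.inj h).2

theorem nil_mem_words (L : Finset ℤ) : [] ∈ Words L := by simp [Words]

theorem cons_mem_words_iff {L : Finset ℤ} {l : ℤ} {w : List ℤ} :
    l :: w ∈ Words L ↔ l ∈ L ∧ w ∈ Words L ∧ ¬ (l = 0 ∧ w = []) := by
  cases w with
  | nil => simp [Words]
  | cons a w => simp [Words, List.getLast?_cons_cons, and_assoc]

/-- The words of `Ω(L)` with at most `n` letters. -/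
def wordsUpTo (L : Finset ℤ) : ℕ → Finset (List ℤ)
  | 0 => {[]}
  | n + 1 => (L ×ˢ wordsUpTo L n).image consWord

theorem mem_words_of_mem_wordsUpTo {L : Finset ℤ} (n : ℕ) {w : List ℤ}
    (hw : w ∈ wordsUpTo L n) : w ∈ Words L := by
  induction n generalizing w with
  | zero =>
    rw [wordsUpTo, Finset.mem_singleton] at hw
    rw [hw]
    exact nil_mem_words L
  | succ n ih =>
    rw [wordsUpTo, Finset.mem_image] at hw
    obtain ⟨⟨l, u⟩, hp, rfl⟩ := hw
    rw [Finset.mem_product] at hp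
    rw [consWord]
    split_ifs with h
    · exact nil_mem_words L
    · exact cons_mem_words_iff.2 ⟨hp.1, ih hp.2, h⟩

theorem nil_mem_wordsUpTo {L : Finset ℤ} (h0 : (0 : ℤ) ∈ L) (n : ℕ) : [] ∈ wordsUpTo L n := by
  induction n with
  | zero => simp [wordsUpTo]
  | succ n ih =>
    rw [wordsUpTo, Finset.mem_image]
    exact ⟨(0, []), Finset.mem_product.2 ⟨h0, ih⟩, by simp [consWord]⟩

theorem mem_wordsUpTo {L : Finset ℤ} (h0 : (0 : ℤ) ∈ L) {w : List ℤ} (hw : w ∈ Words L) {n : ℕ}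
    (hn : w.length ≤ n) : w ∈ wordsUpTo L n := by
  induction w generalizing n with
  | nil => exact nil_mem_wordsUpTo h0 n
  | cons l w ih =>
    obtain ⟨hl, hw', hne⟩ := cons_mem_words_iff.1 hw
    obtain ⟨m, rfl⟩ : ∃ m, n = m + 1 := ⟨n - 1, by simp at hn; omega⟩
    rw [wordsUpTo, Finset.mem_image]
    refine ⟨(l, w), Finset.mem_product.2 ⟨hl, ih hw' (by simpa using hn)⟩, ?_⟩
    simp only [consWord]
    rw [if_neg hne]

theorem wordsUpTo_mono {L : Finset ℤ} (h0 : (0 : ℤ) ∈ L) : Monotone (wordsUpTo L) := by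
  refine monotone_nat_of_le_succ fun n => ?_
  induction n with
  | zero =>
    intro w hw
    rw [wordsUpTo, Finset.mem_singleton] at hw
    rw [hw]
    exact nil_mem_wordsUpTo h0 1
  | succ n ih =>
    rw [wordsUpTo, wordsUpTo]
    exact Finset.image_subset_image (Finset.product_subset_product_right ih)

variable {R : ℤ} {B : Finset ℤ} {μ : ProbabilityMeasure ℝ}

theorem IsSelfAffine.frameCoeff_consWord (h : IsSelfAffine R B μ) (hR : R ≠ 0) {α : ℤ → ℂ}
    (hα : α 0 = 1) (p : ℤ × List ℤ) {v : ℝ → ℂ} (hv : Integrable v (μ : Measure ℝ)) :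
    frameCoeff μ R α (consWord p) v = frameCoeff μ R α p.2 (transfer R B α p.1 v) := by
  obtain ⟨l, w⟩ := p
  simp only [consWord]
  split_ifs with hlw
  · obtain ⟨rfl, rfl⟩ := hlw
    rw [frameCoeff_nil, frameCoeff_nil, h.integral_transfer_zero hα hv]
  · exact h.frameCoeff_cons hR α l w hv

theorem IsSelfAffine.sum_wordsUpTo_succ (h : IsSelfAffine R B μ) (hR : R ≠ 0) (L : Finset ℤ)
    {α : ℤ → ℂ} (hα : α 0 = 1) (n : ℕ) {v : ℝ → ℂ} (hv : Integrable v (μ : Measure ℝ)) :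
    ∑ w ∈ wordsUpTo L (n + 1), ‖frameCoeff μ R α w v‖ ^ 2 =
      ∑ l ∈ L, ∑ w ∈ wordsUpTo L n, ‖frameCoeff μ R α w (transfer R B α l v)‖ ^ 2 := by
  rw [wordsUpTo, Finset.sum_image (consWord_injective.injOn), Finset.sum_product]
  exact Finset.sum_congr rfl fun l _ => Finset.sum_congr rfl fun w _ => by
    rw [h.frameCoeff_consWord hR hα (l, w) hv]

theorem norm_integral_sq_le {v : ℝ → ℂ} (hv : MemLp v 2 (μ : Measure ℝ)) :
    ‖∫ x, v x ∂(μ : Measure ℝ)‖ ^ 2 ≤ ∫ x, ‖v x‖ ^ 2 ∂(μ : Measure ℝ) := by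
  have hi : Integrable v (μ : Measure ℝ) := hv.integrable one_le_two
  calc ‖∫ x, v x ∂(μ : Measure ℝ)‖ ^ 2 ≤ (∫ x, ‖v x‖ ∂(μ : Measure ℝ)) ^ 2 := by
        gcongr
        exact norm_integral_le_integral_norm v
    _ ≤ ∫ x, ‖v x‖ ^ 2 ∂(μ : Measure ℝ) :=
        (convexOn_pow 2).map_integral_le (by fun_prop) isClosed_Ici
          (Filter.Eventually.of_forall fun x => norm_nonneg (v x)) hi.norm
          (hv.integrable_norm_pow two_ne_zero)

theorem IsSelfAffine.sum_wordsUpTo_le (h : IsSelfAffine R B μ) (hR : R ≠ 0) {L : Finset ℤ}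
    {α : ℤ → ℂ} (hα : α 0 = 1) (hT : IsIsometryCondition R B L α) (n : ℕ) {v : ℝ → ℂ}
    (hv : MemLp v 2 (μ : Measure ℝ)) :
    ∑ w ∈ wordsUpTo L n, ‖frameCoeff μ R α w v‖ ^ 2 ≤ ∫ x, ‖v x‖ ^ 2 ∂(μ : Measure ℝ) := by
  induction n generalizing v with
  | zero =>
    rw [wordsUpTo, Finset.sum_singleton, frameCoeff_nil]
    exact norm_integral_sq_le hv
  | succ n ih =>
    rw [h.sum_wordsUpTo_succ hR L hα n (hv.integrable one_le_two),
      ← h.sum_integral_norm_sq_transfer hT hv]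
    exact Finset.sum_le_sum fun l _ => ih (h.memLp_transfer α l hv)

theorem IsSelfAffine.sum_words_le (h : IsSelfAffine R B μ) (hR : R ≠ 0) {L : Finset ℤ}
    (h0 : (0 : ℤ) ∈ L) {α : ℤ → ℂ} (hα : α 0 = 1) (hT : IsIsometryCondition R B L α)
    (s : Finset (Words L)) {v : ℝ → ℂ} (hv : MemLp v 2 (μ : Measure ℝ)) :
    ∑ w ∈ s, ‖frameCoeff μ R α w v‖ ^ 2 ≤ ∫ x, ‖v x‖ ^ 2 ∂(μ : Measure ℝ) := by
  classical
  refine le_trans ?_ (h.sum_wordsUpTo_le hR hα hT (s.sup fun w => w.1.length) hv)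
  rw [← Finset.sum_image (s := s) (g := fun w : Words L => (w : List ℤ))
    (f := fun w => ‖frameCoeff μ R α w v‖ ^ 2) Subtype.val_injective.injOn]
  refine Finset.sum_le_sum_of_subset_of_nonneg ?_ fun _ _ _ => by positivity
  intro w hw
  obtain ⟨u, hu, rfl⟩ := Finset.mem_image.1 hw
  exact mem_wordsUpTo h0 u.2 (Finset.le_sup (f := fun w : Words L => w.1.length) hu)

theorem IsSelfAffine.summable_frameCoeff (h : IsSelfAffine R B μ) (hR : R ≠ 0) {L : Finset ℤ}
    (h0 : (0 : ℤ) ∈ L) {α : ℤ → ℂ} (hα : α 0 = 1) (hT : IsIsometryCondition R B L α)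
    {v : ℝ → ℂ} (hv : MemLp v 2 (μ : Measure ℝ)) :
    Summable fun w : Words L => ‖frameCoeff μ R α w v‖ ^ 2 :=
  summable_of_sum_le (fun _ => by positivity) fun s => h.sum_words_le hR h0 hα hT s hv

theorem tendsto_sum_wordsUpTo {L : Finset ℤ} (h0 : (0 : ℤ) ∈ L) {f : List ℤ → ℝ}
    (hf : Summable fun w : Words L => f w) :
    Filter.Tendsto (fun n => ∑ w ∈ wordsUpTo L n, f w) Filter.atTop
      (nhds (∑' w : Words L, f w)) := by
  classical
  have h1 : Filter.Tendsto (fun n => (wordsUpTo L n).subtype (· ∈ Words L)) Filter.atTop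
      Filter.atTop := by
    refine Filter.tendsto_atTop_finset_of_monotone
      (fun m n hmn => Finset.subtype_mono (wordsUpTo_mono h0 hmn)) fun w => ?_
    exact ⟨w.1.length, by simpa using mem_wordsUpTo h0 w.2 le_rfl⟩
  refine (hf.hasSum.comp h1).congr fun n => ?_
  exact Finset.sum_subtype_of_mem f fun w hw => mem_words_of_mem_wordsUpTo n hw

/-- The transfer operators preserve the total energy of the frame coefficients. -/
theorem IsSelfAffine.tsum_frameCoeff_eq (h : IsSelfAffine R B μ) (hR : R ≠ 0) {L : Finset ℤ}
    (h0 : (0 : ℤ) ∈ L) {α : ℤ → ℂ} (hα : α 0 = 1) (hT : IsIsometryCondition R B L α)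
    {v : ℝ → ℂ} (hv : MemLp v 2 (μ : Measure ℝ)) :
    ∑' w : Words L, ‖frameCoeff μ R α w v‖ ^ 2 =
      ∑ l ∈ L, ∑' w : Words L, ‖frameCoeff μ R α w (transfer R B α l v)‖ ^ 2 := by
  have h1 := (Filter.tendsto_add_atTop_iff_nat 1).2 (tendsto_sum_wordsUpTo h0
    (f := fun w => ‖frameCoeff μ R α w v‖ ^ 2) (h.summable_frameCoeff hR h0 hα hT hv))
  have h2 := tendsto_finsetSum L fun l _ => tendsto_sum_wordsUpTo h0
    (f := fun w => ‖frameCoeff μ R α w (transfer R B α l v)‖ ^ 2)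
    (h.summable_frameCoeff hR h0 hα hT (h.memLp_transfer α l hv))
  refine tendsto_nhds_unique h1 (h2.congr fun n => ?_)
  exact (h.sum_wordsUpTo_succ hR L hα n (hv.integrable one_le_two)).symm

/-! ### Frame coefficients as inner products -/

theorem coeFn_expL2 (t : ℝ) : expL2 μ t =ᵐ[(μ : Measure ℝ)] expFun t :=
  (memLp_expFun μ t).coeFn_toLp

theorem inner_weightedExponentials (L : Finset ℤ) (α : ℤ → ℂ) (w : Words L)
    (v : Lp ℂ 2 (μ : Measure ℝ)) :
    inner ℂ (weightedExponentials μ R L α w) v = frameCoeff μ R α w v := by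
  rw [L2.inner_def, frameCoeff]
  refine integral_congr_ae ?_
  filter_upwards [Lp.coeFn_smul (weight α w) (expL2 μ (frequency R w : ℝ)),
    coeFn_expL2 (frequency R w : ℝ)] with x hx1 hx2
  rw [weightedExponentials, hx1, Pi.smul_apply, hx2, RCLike.inner_apply, smul_eq_mul,
    map_mul, conj_expFun]
  ring

theorem frameCoeff_congr_ae (α : ℤ → ℂ) (w : List ℤ) {u v : ℝ → ℂ}
    (h : u =ᵐ[(μ : Measure ℝ)] v) : frameCoeff μ R α w u = frameCoeff μ R α w v := by
  refine integral_congr_ae ?_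
  filter_upwards [h] with x hx
  rw [hx]

theorem norm_sq_eq_integral (v : Lp ℂ 2 (μ : Measure ℝ)) :
    ‖v‖ ^ 2 = ∫ x, ‖v x‖ ^ 2 ∂(μ : Measure ℝ) := by
  have h := inner_self_eq_norm_sq (𝕜 := ℂ) v
  rw [L2.inner_def] at h
  rw [← h]
  have : ∀ x, inner ℂ (v x) (v x) = ((‖v x‖ ^ 2 : ℝ) : ℂ) := fun x => by
    rw [inner_self_eq_norm_sq_to_K]
    norm_cast
  simp only [this]
  rw [integral_complex_ofReal]
  simp

theorem norm_expL2 (t : ℝ) : ‖expL2 μ t‖ ^ 2 = 1 := by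
  rw [norm_sq_eq_integral]
  have : ∀ᵐ x ∂(μ : Measure ℝ), ‖expL2 μ t x‖ ^ 2 = 1 := by
    filter_upwards [coeFn_expL2 t] with x hx
    rw [hx, norm_expFun, one_pow]
  rw [integral_congr_ae this]
  simp

/-! ### Bessel families -/

section Bessel

variable {ι H : Type*} [NormedAddCommGroup H] [InnerProductSpace ℂ H]

/-- `e` is a Bessel family with bound `1`. -/
def IsBessel (e : ι → H) : Prop :=
  ∀ (s : Finset ι) (v : H), ∑ i ∈ s, ‖inner ℂ (e i) v‖ ^ 2 ≤ ‖v‖ ^ 2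

theorem IsBessel.summable {e : ι → H} (h : IsBessel e) (v : H) :
    Summable fun i => ‖inner ℂ (e i) v‖ ^ 2 :=
  summable_of_sum_le (fun _ => by positivity) fun s => h s v

theorem IsBessel.tsum_le {e : ι → H} (h : IsBessel e) (v : H) :
    ∑' i, ‖inner ℂ (e i) v‖ ^ 2 ≤ ‖v‖ ^ 2 :=
  (h.summable v).tsum_le_of_sum_le fun s => h s v

theorem IsBessel.exists_analysis {e : ι → H} (h : IsBessel e) :
    ∃ C : H →L[ℂ] lp (fun _ : ι => ℂ) 2, ∀ v, ‖C v‖ ^ 2 = ∑' i, ‖inner ℂ (e i) v‖ ^ 2 := by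
  have hmem : ∀ v, Memℓp (fun i => (inner ℂ (e i) v : ℂ)) 2 := fun v =>
    memℓp_gen (by simpa using h.summable v)
  have hnorm : ∀ v, ‖(⟨_, hmem v⟩ : lp (fun _ : ι => ℂ) 2)‖ ^ 2 =
      ∑' i, ‖inner ℂ (e i) v‖ ^ 2 := fun v => by
    have := lp.norm_rpow_eq_tsum (p := 2) (by simp) (⟨_, hmem v⟩ : lp (fun _ : ι => ℂ) 2)
    simpa using this
  let A : H →ₗ[ℂ] lp (fun _ : ι => ℂ) 2 :=
    { toFun := fun v => ⟨_, hmem v⟩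
      map_add' := fun u v => by
        ext i
        exact inner_add_right _ _ _
      map_smul' := fun c v => by
        ext i
        exact inner_smul_right _ _ _ }
  refine ⟨A.mkContinuous 1 fun v => ?_, hnorm⟩
  rw [one_mul]
  refine le_of_sq_le_sq ?_ (norm_nonneg _)
  exact (hnorm v).trans_le (h.tsum_le v)

/-- A Bessel family that satisfies Parseval's identity on a total set is a Parseval frame. -/
theorem IsBessel.isParsevalFrame [CompleteSpace H] {e : ι → H} (h : IsBessel e) {κ : Type*}
    (u : κ → H) (hu : ∀ k, ∑' i, ‖inner ℂ (e i) (u k)‖ ^ 2 = ‖u k‖ ^ 2)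
    (htot : ∀ v, (∀ k, inner ℂ (u k) v = 0) → v = 0) : IsParsevalFrame e := by
  obtain ⟨C, hC⟩ := h.exists_analysis
  set D := ContinuousLinearMap.adjoint C ∘L C with hD
  have hDre : ∀ v, RCLike.re (inner ℂ (D v) v) = ‖C v‖ ^ 2 := fun v =>
    (ContinuousLinearMap.apply_norm_sq_eq_inner_adjoint_left C v).symm
  have hCle : ∀ v, ‖C v‖ ≤ ‖v‖ := fun v =>
    le_of_sq_le_sq ((hC v).trans_le (h.tsum_le v)) (norm_nonneg _)
  have hDle : ∀ v, ‖D v‖ ≤ ‖C v‖ := fun v => by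
    have h1 : ‖D v‖ ^ 2 ≤ ‖D v‖ * ‖C v‖ := by
      have h2 : RCLike.re (inner ℂ (D v) (D v)) = ‖D v‖ ^ 2 := inner_self_eq_norm_sq _
      have h3 : (inner ℂ (D v) (D v) : ℂ) = inner ℂ (C v) (C (D v)) := by
        conv_lhs => rw [hD, ContinuousLinearMap.comp_apply,
          ContinuousLinearMap.adjoint_inner_left]
        rfl
      rw [← h2, h3]
      calc _ ≤ ‖(inner ℂ (C v) (C (D v)) : ℂ)‖ := RCLike.re_le_norm _
        _ ≤ ‖C v‖ * ‖C (D v)‖ := norm_inner_le_norm _ _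
        _ ≤ ‖C v‖ * ‖D v‖ := by gcongr; exact hCle _
        _ = _ := mul_comm _ _
    by_contra! hlt
    have := norm_nonneg (C v)
    nlinarith
  have hDu : ∀ k, D (u k) = u k := fun k => by
    have hCu : ‖C (u k)‖ ^ 2 = ‖u k‖ ^ 2 := (hC _).trans (hu k)
    have h1 : ‖D (u k) - u k‖ ^ 2 ≤ 0 := by
      rw [norm_sub_sq (𝕜 := ℂ), hDre, hCu]
      have := pow_le_pow_left₀ (norm_nonneg _) (hDle (u k)) 2
      linarith
    have h2 : ‖D (u k) - u k‖ = 0 := by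
      nlinarith [norm_nonneg (D (u k) - u k)]
    exact sub_eq_zero.1 (norm_eq_zero.1 h2)
  have hDv : ∀ v, D v = v := fun v => by
    refine sub_eq_zero.1 (htot _ fun k => ?_)
    rw [inner_sub_right]
    have : (inner ℂ (u k) (D v) : ℂ) = inner ℂ (D (u k)) v := by
      rw [hD, ContinuousLinearMap.comp_apply, ContinuousLinearMap.comp_apply,
        ContinuousLinearMap.adjoint_inner_left, ContinuousLinearMap.adjoint_inner_right]
    rw [this, hDu, sub_self]
  intro v
  have h1 : ∑' i, ‖inner ℂ (e i) v‖ ^ 2 = ‖v‖ ^ 2 := by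
    rw [← hC, ← hDre, hDv, inner_self_eq_norm_sq]
  rw [← h1]
  exact (h.summable v).hasSum

end Bessel

theorem IsSelfAffine.isBessel (h : IsSelfAffine R B μ) (hR : R ≠ 0) {L : Finset ℤ}
    (h0 : (0 : ℤ) ∈ L) {α : ℤ → ℂ} (hα : α 0 = 1) (hT : IsIsometryCondition R B L α) :
    IsBessel (weightedExponentials μ R L α) := fun s v => by
  simp only [inner_weightedExponentials]
  rw [norm_sq_eq_integral]
  exact h.sum_words_le hR h0 hα hT s (Lp.memLp v)

end

section

variable {R : ℤ} {B : Finset ℤ} {μ : ProbabilityMeasure ℝ}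

/-! ### Exponentials are total -/

theorem integrable_real_eq_zero_of_charFun {f : ℝ → ℝ} (hf : Integrable f (μ : Measure ℝ))
    (h : ∀ t : ℝ, ∫ x, expFun t x * (f x : ℂ) ∂(μ : Measure ℝ) = 0) :
    f =ᵐ[(μ : Measure ℝ)] 0 := by
  set ν : (ℝ → ℝ) → Measure ℝ := fun g =>
    (μ : Measure ℝ).withDensity fun x => ENNReal.ofReal (g x) with hν
  have hfin : ∀ g, Integrable g (μ : Measure ℝ) → IsFiniteMeasure (ν g) := fun g hg =>
    isFiniteMeasure_withDensity_ofReal hg.2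
  have := hfin f hf
  have := hfin (-f) hf.neg
  have hint : ∀ (t : ℝ) {g : ℝ → ℂ}, Integrable g (μ : Measure ℝ) →
      Integrable (fun x => expFun t x * g x) (μ : Measure ℝ) := fun t g hg =>
    hg.bdd_mul (c := 1) (continuous_expFun t).aestronglyMeasurable
      (Filter.Eventually.of_forall fun x => (norm_expFun t x).le)
  have hchar : ∀ (t : ℝ) (g : ℝ → ℝ), Integrable g (μ : Measure ℝ) → charFun (ν g) t =
      ∫ x, expFun (t / (2 * Real.pi)) x * ((max (g x) 0 : ℝ) : ℂ) ∂(μ : Measure ℝ) := by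
    intro t g hg
    rw [charFun_apply_real, hν]
    rw [integral_withDensity_eq_integral_toReal_smul₀ (by fun_prop)
      (Filter.Eventually.of_forall fun x => ENNReal.ofReal_lt_top)]
    refine integral_congr_ae (Filter.Eventually.of_forall fun x => ?_)
    simp only [ENNReal.toReal_ofReal', Complex.real_smul, expFun]
    rw [mul_comm]
    congr 2
    have : (Real.pi : ℂ) ≠ 0 := by exact_mod_cast Real.pi_ne_zero
    push_cast
    field_simp
  have hpos : ∀ g : ℝ → ℝ, Integrable g (μ : Measure ℝ) →
      Integrable (fun x => ((max (g x) 0 : ℝ) : ℂ)) (μ : Measure ℝ) := fun g hg =>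
    hg.pos_part.ofReal
  have heq : ν f = ν (-f) := by
    refine Measure.ext_of_charFun (funext fun t => ?_)
    rw [hchar t f hf, hchar t (-f) hf.neg, ← sub_eq_zero,
      ← integral_sub (hint _ (hpos f hf)) (hint _ (hpos (-f) hf.neg)), ← h (t / (2 * Real.pi))]
    refine integral_congr_ae (Filter.Eventually.of_forall fun x => ?_)
    simp only [Pi.neg_apply]
    rw [← mul_sub, ← Complex.ofReal_sub, max_zero_sub_max_neg_zero_eq_self]
  have hae := (withDensity_eq_iff hf.aestronglyMeasurable.aemeasurable.ennreal_ofReal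
    hf.neg.aestronglyMeasurable.aemeasurable.ennreal_ofReal
    hf.lintegral_lt_top.ne).1 heq
  filter_upwards [hae] with x hx
  have h2 := congrArg ENNReal.toReal hx
  rw [ENNReal.toReal_ofReal', ENNReal.toReal_ofReal'] at h2
  have h3 := max_zero_sub_max_neg_zero_eq_self (f x)
  rw [h2] at h3
  simpa using h3.symm

theorem eq_zero_of_inner_expL2 (v : Lp ℂ 2 (μ : Measure ℝ))
    (h : ∀ t : ℝ, inner ℂ (expL2 μ t) v = 0) : v = 0 := by
  have hv : Integrable (v : ℝ → ℂ) (μ : Measure ℝ) := (Lp.memLp v).integrable one_le_two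
  have h1 : ∀ t : ℝ, ∫ x, expFun t x * v x ∂(μ : Measure ℝ) = 0 := fun t => by
    rw [← h (-t), L2.inner_def]
    refine integral_congr_ae ?_
    filter_upwards [coeFn_expL2 (-t)] with x hx
    rw [hx, RCLike.inner_apply, conj_expFun, neg_neg, mul_comm]
  have hint : ∀ (t : ℝ) {g : ℝ → ℂ}, Integrable g (μ : Measure ℝ) →
      Integrable (fun x => expFun t x * g x) (μ : Measure ℝ) := fun t g hg =>
    hg.bdd_mul (c := 1) (continuous_expFun t).aestronglyMeasurable
      (Filter.Eventually.of_forall fun x => (norm_expFun t x).le)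
  have h2 : ∀ t : ℝ, ∫ x, expFun t x * starRingEnd ℂ (v x) ∂(μ : Measure ℝ) = 0 := fun t => by
    have h3 := congrArg (starRingEnd ℂ) (h1 (-t))
    rw [← integral_conj, map_zero] at h3
    rw [← h3]
    refine integral_congr_ae (Filter.Eventually.of_forall fun x => ?_)
    simp only [map_mul, conj_expFun, neg_neg]
  have hconj : Integrable (fun x => starRingEnd ℂ (v x)) (μ : Measure ℝ) :=
    (LinearIsometryEquiv.integrable_comp_iff Complex.conjLIE).2 hv
  have hre := integrable_real_eq_zero_of_charFun hv.re fun t => by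
    have : ∀ x, expFun t x * ((RCLike.re (v x) : ℝ) : ℂ) =
        2⁻¹ * (expFun t x * v x + expFun t x * starRingEnd ℂ (v x)) := fun x => by
      rw [← mul_add, Complex.add_conj]
      simp only [RCLike.re_eq_complex_re]
      push_cast
      ring
    simp only [this]
    rw [integral_const_mul, integral_add (hint t hv) (hint t hconj), h1, h2]
    simp
  have him := integrable_real_eq_zero_of_charFun hv.im fun t => by
    have : ∀ x, expFun t x * ((RCLike.im (v x) : ℝ) : ℂ) =
        (2 * Complex.I)⁻¹ * (expFun t x * v x - expFun t x * starRingEnd ℂ (v x)) := fun x => by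
      rw [← mul_sub, Complex.sub_conj]
      simp only [RCLike.im_eq_complex_im]
      have := Complex.I_ne_zero
      field_simp
      push_cast
      ring
    simp only [this]
    rw [integral_const_mul, integral_sub (hint t hv) (hint t hconj), h1, h2]
    simp
  refine Lp.eq_zero_iff_ae_eq_zero.2 ?_
  filter_upwards [hre, him] with x hx1 hx2
  exact Complex.ext hx1 hx2

/-! ### Analyticity of exponentials in `L²` -/

open scoped BoundedContinuousFunction in
theorem analyticAt_expL2 {M : ℝ} (hM : ∀ᵐ x ∂(μ : Measure ℝ), |x| ≤ M) (t₀ : ℝ) :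
    AnalyticAt ℝ (fun t => expL2 μ t) t₀ := by
  let a : ℝ →ᵇ ℂ := BoundedContinuousFunction.ofNormedAddCommGroup
    (fun x => 2 * Real.pi * Complex.I * ((max (-M) (min x M) : ℝ) : ℂ)) (by fun_prop)
    (2 * Real.pi * |M|) fun x => by
      have hx : |max (-M) (min x M)| ≤ |M| := by
        rw [abs_le]
        refine ⟨le_max_of_le_left (neg_le_neg (le_abs_self M)), max_le (neg_le_abs M) ?_⟩
        exact (min_le_right _ _).trans (le_abs_self M)
      rw [norm_mul, norm_mul, norm_mul, Complex.norm_I, Complex.norm_real, Complex.norm_real,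
        Real.norm_eq_abs, Real.norm_eq_abs, abs_of_pos Real.pi_pos, mul_one, Complex.norm_ofNat]
      gcongr
  let Φ : (ℝ →ᵇ ℂ) →L[ℝ] Lp ℂ 2 (μ : Measure ℝ) :=
    BoundedContinuousFunction.toLp 2 (μ : Measure ℝ) ℝ
  have key : (fun t => expL2 μ t) = fun t : ℝ => Φ (NormedSpace.exp (t • a)) := by
    funext t
    refine Lp.ext ?_
    filter_upwards [coeFn_expL2 t,
      BoundedContinuousFunction.coeFn_toLp (p := 2) (μ := (μ : Measure ℝ)) (𝕜 := ℝ)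
        (NormedSpace.exp (t • a)), hM] with x hx1 hx2 hx
    rw [hx1, hx2]
    let ev : (ℝ →ᵇ ℂ) →+* ℂ :=
      { toFun := fun f => f x
        map_one' := rfl
        map_mul' := fun _ _ => rfl
        map_zero' := rfl
        map_add' := fun _ _ => rfl }
    have hev : Continuous ev := (BoundedContinuousFunction.evalCLM ℝ x).continuous
    have h1 : (NormedSpace.exp (t • a)) x = NormedSpace.exp ((t • a) x) :=
      NormedSpace.map_exp ev hev (t • a)
    have hx' : max (-M) (min x M) = x := by
      rw [min_eq_left (le_of_abs_le hx), max_eq_right (neg_le_of_abs_le hx)]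
    have h2 : (t • a) x = 2 * Real.pi * Complex.I * t * x := by
      rw [BoundedContinuousFunction.smul_apply]
      show t • (2 * Real.pi * Complex.I * ((max (-M) (min x M) : ℝ) : ℂ)) = _
      rw [hx', Complex.real_smul]
      ring
    rw [h1, h2, ← Complex.exp_eq_exp_ℂ, expFun]
  rw [key]
  refine (Φ.analyticAt _).comp ?_
  refine AnalyticAt.comp (g := NormedSpace.exp) (NormedSpace.exp_analytic _) ?_
  exact ((ContinuousLinearMap.id ℝ ℝ).smulRight a).analyticAt t₀

theorem analyticAt_norm_sq_clm {H : Type*} [NormedAddCommGroup H] [InnerProductSpace ℂ H]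
    [CompleteSpace H]
    (C : Lp ℂ 2 (μ : Measure ℝ) →L[ℂ] H)
    {M : ℝ} (hM : ∀ᵐ x ∂(μ : Measure ℝ), |x| ≤ M) (t₀ : ℝ) :
    AnalyticAt ℝ (fun t => ‖C (expL2 μ t)‖ ^ 2) t₀ := by
  let : InnerProductSpace ℝ H := InnerProductSpace.rclikeToReal ℂ H
  have h1 : AnalyticAt ℝ (fun t => C (expL2 μ t)) t₀ :=
    ((C.restrictScalars ℝ).analyticAt _).comp (analyticAt_expL2 hM t₀)
  exact (h1.contDiffAt.norm_sq ℝ).analyticAt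

end

section

/-! ### Bounded analytic harmonic functions of the random walk `t ↦ (t - l) / R` -/

/-- On a finite set invariant under maps of the form `t ↦ (t - l) / R` all points are rational with
denominators of the form `R ^ n - 1`. -/
theorem exists_pow_sub_one_mul_eq_int {R : ℤ} (hR : R ≠ 0) {Z : Set ℝ} (hZ : Z.Finite) {σ : ℝ → ℝ}
    (hσZ : Set.MapsTo σ Z Z) (hσ : ∀ t ∈ Z, ∃ l : ℤ, σ t = (t - l) / R) {t : ℝ} (ht : t ∈ Z) :
    ∃ n : ℕ, 1 ≤ n ∧ ∃ m : ℤ, ((R : ℝ) ^ n - 1) * t = m := by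
  have hR' : (R : ℝ) ≠ 0 := by exact_mod_cast hR
  have hmem : ∀ k, σ^[k] t ∈ Z := fun k => hσZ.iterate k ht
  have hiter : ∀ k : ℕ, ∃ m : ℤ, t = (R : ℝ) ^ k * σ^[k] t + m := by
    intro k
    induction k with
    | zero => exact ⟨0, by simp⟩
    | succ k ih =>
      obtain ⟨m, hm⟩ := ih
      obtain ⟨l, hl⟩ := hσ _ (hmem k)
      refine ⟨R ^ k * l + m, ?_⟩
      rw [Function.iterate_succ_apply', hl]
      conv_lhs => rw [hm]
      push_cast
      field_simp
      ring
  have hfin : Finite Z := hZ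
  obtain ⟨i, j, hij, heq⟩ := Finite.exists_ne_map_eq_of_infinite
    fun k : ℕ => (⟨σ^[k] t, hmem k⟩ : Z)
  have heq' : σ^[i] t = σ^[j] t := congrArg Subtype.val heq
  wlog h : i < j generalizing i j
  · exact this j i hij.symm heq.symm heq'.symm (lt_of_le_of_ne (not_lt.1 h) hij.symm)
  obtain ⟨m, hm⟩ := hiter i
  obtain ⟨m', hm'⟩ := hiter j
  obtain ⟨n, rfl⟩ := Nat.exists_eq_add_of_lt h
  refine ⟨n + 1, by omega, R ^ (n + 1) * m - m', ?_⟩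
  rw [← heq'] at hm'
  have e : (R : ℝ) ^ (i + n + 1) = R ^ (n + 1) * R ^ i := by ring
  rw [e] at hm'
  push_cast
  linear_combination (R : ℝ) ^ (n + 1) * hm - hm'

theorem harmonic_nonpos {R : ℤ} (hR : 2 ≤ |R|) {L : Finset ℤ}
    {g : ℝ → ℝ} (hg : AnalyticOnNhd ℝ g Set.univ) (hg0 : g 0 = 0) {p : ℤ → ℝ → ℝ}
    (hp : ∀ l t, 0 ≤ p l t) (hp1 : ∀ t, ∑ l ∈ L, p l t = 1)
    (hharm : ∀ t, g t = ∑ l ∈ L, p l t * g ((t - l) / R))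
    (hinc : ∀ t, ∀ l ∈ L, l ≠ 0 → 0 < p l t →
      ∃ l₁ ∈ L, ∃ l₂ ∈ L, 0 < p l₁ t ∧ 0 < p l₂ t ∧ ¬ l₁ ≡ l₂ [ZMOD R]) (t₀ : ℝ) :
    g t₀ ≤ 0 := by
  have hR0 : R ≠ 0 := by
    rintro rfl
    simp at hR
  have hR2 : (2 : ℝ) ≤ |(R : ℝ)| := by exact_mod_cast hR
  have hR' : (R : ℝ) ≠ 0 := by exact_mod_cast hR0
  have hcont : Continuous g := continuous_iff_continuousAt.2 fun t => (hg t trivial).continuousAt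
  set ρ : ℝ := max |t₀| (∑ l ∈ L, |(l : ℝ)|) with hρ
  have hρ0 : 0 ≤ ρ := (abs_nonneg t₀).trans (le_max_left _ _)
  have hinv : ∀ t ∈ Set.Icc (-ρ) ρ, ∀ l ∈ L, (t - l) / (R : ℝ) ∈ Set.Icc (-ρ) ρ := by
    intro t ht l hl
    have hl' : |(l : ℝ)| ≤ ρ := (Finset.single_le_sum (f := fun l : ℤ => |(l : ℝ)|)
      (fun _ _ => abs_nonneg _) hl).trans (le_max_right _ _)
    have ht' : |t| ≤ ρ := abs_le.2 ht
    rw [Set.mem_Icc, ← abs_le, abs_div, div_le_iff₀ (by linarith)]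
    have h1 := abs_sub t (l : ℝ)
    have h2 : ρ * 2 ≤ ρ * |(R : ℝ)| := by gcongr
    linarith
  obtain ⟨z, hzK, hz⟩ := isCompact_Icc.exists_isMaxOn (s := Set.Icc (-ρ) ρ)
    ⟨0, by simpa using hρ0⟩ hcont.continuousOn
  have ht₀ : t₀ ∈ Set.Icc (-ρ) ρ := abs_le.1 (le_max_left _ _)
  have hmax : ∀ t ∈ Set.Icc (-ρ) ρ, g t ≤ g z := fun t ht => hz ht
  refine (hmax _ ht₀).trans ?_
  by_contra! hM
  set Z : Set ℝ := {t | t ∈ Set.Icc (-ρ) ρ ∧ g t = g z} with hZ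
  have hZinv : ∀ t ∈ Z, ∀ l ∈ L, 0 < p l t → (t - l) / (R : ℝ) ∈ Z := by
    rintro t ⟨htK, htM⟩ l hl hpl
    refine ⟨hinv t htK l hl, ?_⟩
    have hsum : ∑ l ∈ L, p l t * (g z - g ((t - l) / R)) = 0 := by
      simp only [mul_sub]
      rw [Finset.sum_sub_distrib, ← hharm, ← Finset.sum_mul, hp1, htM]
      ring
    have hterm := (Finset.sum_eq_zero_iff_of_nonneg fun l hl =>
      mul_nonneg (hp l t) (sub_nonneg.2 (hmax _ (hinv t htK l hl)))).1 hsum l hl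
    rcases mul_eq_zero.1 hterm with h | h
    · exact absurd h hpl.ne'
    · exact (sub_eq_zero.1 h).symm
  have hZfin : Z.Finite := by
    by_contra hinf
    obtain ⟨c, -, hc⟩ := Set.Infinite.exists_accPt_of_subset_isCompact hinf
      (isCompact_Icc (a := -ρ) (b := ρ)) fun t ht => ht.1
    have hfreq : ∃ᶠ t in nhdsWithin c {c}ᶜ, g t = g z :=
      (accPt_iff_frequently_nhdsNE.1 hc).mono fun t ht => ht.2
    have := hg.eqOn_of_preconnected_of_frequently_eq (g := fun _ => g z) analyticOnNhd_const
      isPreconnected_univ trivial hfreq (Set.mem_univ (0 : ℝ))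
    simp only [hg0] at this
    linarith
  have hstep : ∀ t, ∃ l ∈ L, 0 < p l t := fun t => by
    by_contra! h
    have h1 := hp1 t
    rw [Finset.sum_eq_zero fun l hl => le_antisymm (h l hl) (hp l t)] at h1
    exact zero_ne_one h1
  choose d hdL hd using hstep
  have hrat : ∀ t ∈ Z, ∃ n : ℕ, 1 ≤ n ∧ ∃ m : ℤ, ((R : ℝ) ^ n - 1) * t = m := fun t ht =>
    exists_pow_sub_one_mul_eq_int hR0 hZfin (σ := fun t => (t - d t) / R)
      (fun t ht => hZinv t ht _ (hdL t) (hd t)) (fun t _ => ⟨d t, rfl⟩) ht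
  have hcop : ∀ n : ℕ, 1 ≤ n → IsCoprime R (R ^ n - 1) := fun n hn => by
    obtain ⟨k, rfl⟩ := Nat.exists_eq_add_of_le' hn
    exact ⟨R ^ k, -1, by ring⟩
  have hcong : ∀ t ∈ Z, ∀ l₁ ∈ L, ∀ l₂ ∈ L, 0 < p l₁ t → 0 < p l₂ t → l₁ ≡ l₂ [ZMOD R] := by
    intro t ht l₁ hl₁ l₂ hl₂ hp₁ hp₂
    obtain ⟨n, hn, m, hm⟩ := hrat _ (hZinv t ht l₁ hl₁ hp₁)
    obtain ⟨n', hn', m', hm'⟩ := hrat _ (hZinv t ht l₂ hl₂ hp₂)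
    have hdvd : R ∣ (R ^ n - 1) * ((R ^ n' - 1) * (l₂ - l₁)) := by
      refine ⟨(R ^ n' - 1) * m - (R ^ n - 1) * m', ?_⟩
      have : (((R ^ n - 1) * ((R ^ n' - 1) * (l₂ - l₁)) : ℤ) : ℝ) =
          ((R * ((R ^ n' - 1) * m - (R ^ n - 1) * m') : ℤ) : ℝ) := by
        push_cast
        rw [← hm, ← hm']
        field_simp
        ring
      exact_mod_cast this
    exact Int.modEq_iff_dvd.2 ((hcop n' hn').dvd_of_dvd_mul_left
      ((hcop n hn).dvd_of_dvd_mul_left hdvd))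
  have hZ0 : ∀ t ∈ Z, t / (R : ℝ) ∈ Z := by
    intro t ht
    have hd0 : d t = 0 := by
      by_contra hne
      obtain ⟨l₁, hl₁, l₂, hl₂, hp₁, hp₂, hne'⟩ := hinc t _ (hdL t) hne (hd t)
      exact hne' (hcong t ht l₁ hl₁ l₂ hl₂ hp₁ hp₂)
    have := hZinv t ht _ (hdL t) (hd t)
    simpa [hd0] using this
  have hpow : ∀ k : ℕ, ((R : ℝ)⁻¹) ^ k * z ∈ Z := by
    intro k
    induction k with
    | zero =>
      rw [pow_zero, one_mul]
      exact ⟨hzK, rfl⟩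
    | succ k ih =>
      have := hZ0 _ ih
      rwa [div_eq_inv_mul, ← mul_assoc, ← pow_succ'] at this
  have hlim : Filter.Tendsto (fun k : ℕ => g (((R : ℝ)⁻¹) ^ k * z)) Filter.atTop (nhds (g 0)) := by
    have h1 : Filter.Tendsto (fun k : ℕ => ((R : ℝ)⁻¹) ^ k * z) Filter.atTop (nhds 0) := by
      simpa using (tendsto_pow_atTop_nhds_zero_of_abs_lt_one (abs_inv_lt_one hR)).mul_const z
    exact (hcont.tendsto 0).comp h1
  have := tendsto_nhds_unique hlim (tendsto_const_nhds.congr fun k => (hpow k).2.symm)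
  linarith

/-! ### The Parseval frame -/

variable {R : ℤ} {B : Finset ℤ} {μ : ProbabilityMeasure ℝ}

/-- The mask `m_B(t) = N⁻¹ ∑_b e_b(t)` of the digit set. -/
noncomputable def mask (B : Finset ℤ) (t : ℝ) : ℂ := (B.card : ℂ)⁻¹ * ∑ b ∈ B, expFun t b

theorem transfer_expFun (α : ℤ → ℂ) (l : ℤ) (t : ℝ) :
    transfer R B α l (expFun t) = fun x =>
      (starRingEnd ℂ (α l) * mask B ((t - l) / R)) * expFun ((t - l) / R) x := by
  funext x
  simp only [transfer, mask, Finset.mul_sum, Finset.sum_mul]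
  refine Finset.sum_congr rfl fun b _ => ?_
  rw [mul_assoc, ← expFun_add_left, expFun_branch, neg_add_eq_sub]
  ring

theorem frameCoeff_const_mul (α : ℤ → ℂ) (w : List ℤ) (c : ℂ) (v : ℝ → ℂ) :
    frameCoeff μ R α w (fun x => c * v x) = c * frameCoeff μ R α w v := by
  rw [frameCoeff, frameCoeff, ← integral_const_mul]
  congr 1
  funext x
  ring

theorem isParsevalFrame_weightedExponentials (hR : 2 ≤ |R|) (h : IsSelfAffine R B μ)
    {L : Finset ℤ} (h0 : (0 : ℤ) ∈ L) {α : ℤ → ℂ} (hα : α 0 = 1)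
    (hT : IsIsometryCondition R B L α)
    (hinc : ∀ t : ℝ, ∀ l ∈ L, l ≠ 0 → α l * mask B ((t - l) / R) ≠ 0 →
      ∃ l₁ ∈ L, ∃ l₂ ∈ L, α l₁ * mask B ((t - l₁) / R) ≠ 0 ∧
        α l₂ * mask B ((t - l₂) / R) ≠ 0 ∧ ¬ l₁ ≡ l₂ [ZMOD R]) :
    IsParsevalFrame (weightedExponentials μ R L α) := by
  have hR0 : R ≠ 0 := by
    rintro rfl
    simp at hR
  have hBes := h.isBessel hR0 h0 hα hT
  obtain ⟨C, hC⟩ := hBes.exists_analysis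
  obtain ⟨M, hM⟩ := h.exists_ae_abs_le hR
  have hCt : ∀ t, ‖C (expL2 μ t)‖ ^ 2 =
      ∑' w : Words L, ‖frameCoeff μ R α w (expFun t)‖ ^ 2 := fun t => by
    rw [hC]
    refine tsum_congr fun w => ?_
    rw [inner_weightedExponentials, frameCoeff_congr_ae α w (coeFn_expL2 t)]
  set p : ℤ → ℝ → ℝ := fun l t => ‖α l * mask B ((t - l) / R)‖ ^ 2 with hp
  have hp1 : ∀ t, ∑ l ∈ L, p l t = 1 := fun t => by
    have h1 := h.sum_integral_norm_sq_transfer hT (memLp_expFun μ t)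
    simp only [transfer_expFun, norm_mul, norm_expFun, RCLike.norm_conj] at h1
    simpa [hp] using h1
  have hharm : ∀ t, ‖C (expL2 μ t)‖ ^ 2 =
      ∑ l ∈ L, p l t * ‖C (expL2 μ ((t - l) / R))‖ ^ 2 := fun t => by
    rw [hCt, h.tsum_frameCoeff_eq hR0 h0 hα hT (memLp_expFun μ t)]
    refine Finset.sum_congr rfl fun l _ => ?_
    rw [hCt, ← tsum_mul_left]
    refine tsum_congr fun w => ?_
    rw [transfer_expFun, frameCoeff_const_mul]
    simp only [hp, norm_mul, RCLike.norm_conj]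
    ring
  have hC0 : 1 ≤ ‖C (expL2 μ 0)‖ ^ 2 := by
    rw [hC]
    refine le_trans ?_ ((hBes.summable (expL2 μ 0)).le_tsum ⟨[], nil_mem_words L⟩
      fun _ _ => by positivity)
    rw [inner_weightedExponentials, frameCoeff_nil,
      integral_congr_ae (coeFn_expL2 0)]
    simp [expFun_zero]
  have hCle : ∀ t, ‖C (expL2 μ t)‖ ^ 2 ≤ 1 := fun t => by
    rw [hC, ← norm_expL2 (μ := μ) t]
    exact hBes.tsum_le _
  have hppos : ∀ {l t}, 0 < p l t ↔ α l * mask B ((t - l) / R) ≠ 0 := fun {l t} => by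
    rw [hp]
    simp only [sq_pos_iff, norm_ne_zero_iff]
  have hle : ∀ t, 1 - ‖C (expL2 μ t)‖ ^ 2 ≤ 0 := by
    refine harmonic_nonpos hR (g := fun t => 1 - ‖C (expL2 μ t)‖ ^ 2) (p := p)
      (fun t _ => analyticAt_const.sub (analyticAt_norm_sq_clm C hM t))
      (by linarith [hCle 0]) (fun _ _ => by positivity) hp1 (fun t => ?_) fun t l hl hl0 hpl => ?_
    · simp only [mul_sub, mul_one]
      rw [Finset.sum_sub_distrib, hp1, ← hharm]
    · simp only [hppos] at hpl ⊢
      exact hinc t l hl hl0 hpl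
  refine hBes.isParsevalFrame (expL2 μ) (fun t => ?_) eq_zero_of_inner_expL2
  rw [← hC, norm_expL2]
  linarith [hle t, hCle t]

end

section

/-! ### Cube roots of unity -/

/-- The cube root of unity `exp(2πi k / 3)`. -/
noncomputable def cubeRoot (k : ℤ) : ℂ := expFun (1 / 3) k

theorem expFun_eq_of_mul_eq {s t x y : ℝ} (h : s * x = t * y) : expFun s x = expFun t y := by
  have h' : (s : ℂ) * x = t * y := by exact_mod_cast h
  rw [expFun, expFun, mul_assoc, mul_assoc _ (t : ℂ), h']

theorem cubeRoot_zero : cubeRoot 0 = 1 := by simp [cubeRoot, expFun]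

theorem cubeRoot_add (k m : ℤ) : cubeRoot (k + m) = cubeRoot k * cubeRoot m := by
  rw [cubeRoot, Int.cast_add, expFun_add_right, cubeRoot, cubeRoot]

theorem cubeRoot_eq_one_iff {k : ℤ} : cubeRoot k = 1 ↔ (3 : ℤ) ∣ k := by
  rw [cubeRoot, expFun, Complex.exp_eq_one_iff]
  have hpi : (Real.pi : ℂ) ≠ 0 := by exact_mod_cast Real.pi_ne_zero
  have hI := Complex.I_ne_zero
  constructor
  · rintro ⟨n, hn⟩
    refine ⟨n, ?_⟩
    have h1 : (2 * Real.pi * Complex.I) * (k : ℂ) = (2 * Real.pi * Complex.I) * (3 * n : ℂ) := by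
      push_cast at hn
      linear_combination 3 * hn
    have h2 := mul_left_cancel₀ (by simp [hpi]) h1
    exact_mod_cast h2
  · rintro ⟨n, rfl⟩
    refine ⟨n, ?_⟩
    push_cast
    ring

theorem cubeRoot_eq_iff {k m : ℤ} : cubeRoot k = cubeRoot m ↔ k ≡ m [ZMOD 3] := by
  have h1 : cubeRoot m = cubeRoot (m - k) * cubeRoot k := by rw [← cubeRoot_add, sub_add_cancel]
  have h2 : cubeRoot k ≠ 0 := Complex.exp_ne_zero _
  rw [Int.modEq_iff_dvd, ← cubeRoot_eq_one_iff, h1]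
  constructor
  · intro h
    exact mul_right_cancel₀ h2 (by rw [← h, one_mul])
  · intro h
    rw [h, one_mul]

theorem cubeRoot_sq_add_self_add_one {k : ℤ} (hk : ¬ (3 : ℤ) ∣ k) :
    cubeRoot k ^ 2 + cubeRoot k + 1 = 0 := by
  have h3 : cubeRoot k ^ 3 = 1 := by
    rw [pow_succ, pow_two, ← cubeRoot_add, ← cubeRoot_add, cubeRoot_eq_one_iff]
    exact ⟨k, by ring⟩
  have h1 : cubeRoot k - 1 ≠ 0 := sub_ne_zero.2 fun h => hk (cubeRoot_eq_one_iff.1 h)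
  refine mul_left_cancel₀ h1 ?_
  linear_combination h3

theorem cubeRoot_two_mul (k : ℤ) : cubeRoot (2 * k) = cubeRoot k ^ 2 := by
  rw [two_mul, cubeRoot_add, pow_two]

/-- Two unimodular numbers that sum to `-1` are the two primitive cube roots of unity. -/
theorem sq_add_self_add_one_of_add_eq_neg_one {z w : ℂ} (hz : ‖z‖ = 1) (hw : ‖w‖ = 1)
    (h : 1 + z + w = 0) : z ^ 2 + z + 1 = 0 := by
  have hz0 : z * starRingEnd ℂ z = 1 := by
    rw [Complex.mul_conj, Complex.normSq_eq_norm_sq, hz]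
    simp
  have hw0 : w * starRingEnd ℂ w = 1 := by
    rw [Complex.mul_conj, Complex.normSq_eq_norm_sq, hw]
    simp
  have h' : 1 + starRingEnd ℂ z + starRingEnd ℂ w = 0 := by
    simpa using congrArg (starRingEnd ℂ) h
  have hzw : z * w + w + z = 0 := by
    linear_combination z * w * h' - w * hz0 - z * hw0
  linear_combination (z + 1) * h - hzw

/-! ### The isometry condition entrywise -/

theorem isIsometryCondition_iff {R : ℤ} {B L : Finset ℤ} {α : ℤ → ℂ} (hB : B.Nonempty) :
    IsIsometryCondition R B L α ↔ ∀ b ∈ B, ∀ b' ∈ B,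
      ∑ l ∈ L, ((‖α l‖ ^ 2 : ℝ) : ℂ) * expFun ((l : ℝ) / R) ((b' - b : ℤ) : ℝ) =
        if b = b' then (B.card : ℂ) else 0 := by
  have hc : (B.card : ℂ) ≠ 0 := by exact_mod_cast hB.card_pos.ne'
  have hsqrt : (((Real.sqrt (B.card : ℝ) : ℝ) : ℂ)⁻¹) ^ 2 = (B.card : ℂ)⁻¹ := by
    rw [inv_pow]
    congr 1
    exact_mod_cast Real.sq_sqrt (Nat.cast_nonneg (α := ℝ) B.card)
  have hentry : ∀ (l : ℤ) (b : ℤ),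
      Complex.exp (2 * Real.pi * Complex.I * ((R : ℂ)⁻¹ * (l : ℂ) * (b : ℂ))) =
        expFun ((l : ℝ) / R) b := fun l b => by
    rw [expFun]
    congr 1
    push_cast
    ring
  have key : ∀ b b' : B, ((weightMatrix R B L α).conjTranspose * weightMatrix R B L α) b b' =
      (B.card : ℂ)⁻¹ * ∑ l ∈ L, ((‖α l‖ ^ 2 : ℝ) : ℂ) *
        expFun ((l : ℝ) / R) (((b' : ℤ) - (b : ℤ) : ℤ) : ℝ) := by
    intro b b'
    rw [Matrix.mul_apply, ← Finset.sum_coe_sort L, Finset.mul_sum]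
    refine Finset.sum_congr rfl fun l _ => ?_
    simp only [Matrix.conjTranspose_apply, weightMatrix, Matrix.of_apply, hentry, RCLike.star_def,
      map_mul, map_inv₀, Complex.conj_ofReal]
    rw [conj_expFun, Int.cast_sub, sub_eq_add_neg, expFun_add_right,
      expFun_eq_of_mul_eq (show -((l : ℤ) / R : ℝ) * ((b : ℤ) : ℝ) =
        ((l : ℤ) / R : ℝ) * -((b : ℤ) : ℝ) by ring), ← hsqrt, Complex.ofReal_pow,
      ← Complex.conj_mul']
    ring
  rw [IsIsometryCondition, ← Matrix.ext_iff]
  constructor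
  · intro h b hb b' hb'
    have := h ⟨b, hb⟩ ⟨b', hb'⟩
    rw [key, inv_mul_eq_iff_eq_mul₀ hc, Matrix.one_apply] at this
    rw [this]
    simp
  · intro h b b'
    rw [key, h b b.2 b' b'.2, Matrix.one_apply]
    simp only [Subtype.ext_iff]
    split_ifs
    · exact inv_mul_cancel₀ hc
    · simp

/-! ### Three digits -/

theorem exists_eq_three_pow_mul {n : ℤ} (hn : n ≠ 0) :
    ∃ (k : ℕ) (m : ℤ), n = 3 ^ k * m ∧ ¬ (3 : ℤ) ∣ m := by
  have hf : FiniteMultiplicity (3 : ℤ) n :=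
    Int.finiteMultiplicity_iff.2 ⟨by decide, hn⟩
  obtain ⟨m, h1, h2⟩ := hf.exists_eq_pow_mul_and_not_dvd
  exact ⟨_, m, h1, h2⟩

theorem three_pow_mul_inj {m n : ℕ} {x y : ℤ} (hx : ¬ (3 : ℤ) ∣ x) (hy : ¬ (3 : ℤ) ∣ y)
    (h : 3 ^ m * x = 3 ^ n * y) : m = n ∧ x = y := by
  have aux : ∀ {m n : ℕ} {x y : ℤ}, ¬ (3 : ℤ) ∣ x → 3 ^ m * x = 3 ^ n * y → n ≤ m := by
    intro m n x y hx h
    by_contra! hlt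
    obtain ⟨k, rfl⟩ := Nat.exists_eq_add_of_lt hlt
    refine hx ⟨3 ^ k * y, mul_left_cancel₀ (pow_ne_zero m (by norm_num : (3 : ℤ) ≠ 0)) ?_⟩
    rw [h]
    ring
  obtain rfl : m = n := le_antisymm (aux hy h.symm) (aux hx h)
  exact ⟨rfl, mul_left_cancel₀ (pow_ne_zero m (by norm_num)) h⟩

theorem not_three_dvd_mul {x y : ℤ} (hx : ¬ (3 : ℤ) ∣ x) (hy : ¬ (3 : ℤ) ∣ y) :
    ¬ (3 : ℤ) ∣ x * y := fun h => (Int.prime_three.dvd_or_dvd h).elim hx hy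

/-- The mass of the digits `l ≠ 0` in the residue class `s_l ≡ c (mod 3)`. -/
noncomputable def classMass (L : Finset ℤ) (α : ℤ → ℂ) (s : ℤ → ℤ) (c : ℤ) : ℝ :=
  ∑ l ∈ L with l ≠ 0 ∧ s l ≡ c [ZMOD 3], ‖α l‖ ^ 2

section

variable {R r : ℤ} {a β : ℕ} {L : Finset ℤ} {α : ℤ → ℂ} {s : ℤ → ℤ}

theorem expFun_eq_cubeRoot {l q σ : ℤ} (hR : R ≠ 0) (ha : 1 ≤ a) (hβ : β ≤ a - 1)
    (hRr : R = 3 ^ a * r) (hr : ¬ (3 : ℤ) ∣ r) (hl : l = 3 ^ (a - 1 - β) * σ) (hd : r ∣ q * σ) :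
    expFun ((l : ℝ) / R) ((3 ^ β * q : ℤ) : ℝ) = cubeRoot (r * q * σ) := by
  obtain ⟨k, hk⟩ := hd
  have hR' : (R : ℝ) ≠ 0 := by exact_mod_cast hR
  have h1 : l * (3 ^ β * q) * 3 = R * k := by
    obtain ⟨c, rfl⟩ : ∃ c, a = c + β + 1 := ⟨a - 1 - β, by omega⟩
    have : c + β + 1 - 1 - β = c := by omega
    rw [hl, hRr, this]
    linear_combination 3 ^ (c + β + 1) * hk
  have h2 : expFun ((l : ℝ) / R) ((3 ^ β * q : ℤ) : ℝ) = cubeRoot k := by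
    refine expFun_eq_of_mul_eq ?_
    have h1' : (l : ℝ) * ((3 ^ β * q : ℤ) : ℝ) * 3 = R * k := by exact_mod_cast h1
    field_simp
    linarith
  rw [h2, cubeRoot_eq_iff, mul_assoc, hk, ← mul_assoc]
  have h3 : r * r ≡ 1 [ZMOD 3] := by
    have : r % 3 = 1 ∨ r % 3 = 2 := by omega
    rcases this with h | h <;> simp [Int.ModEq, Int.mul_emod, h]
  simpa using (h3.mul_right k).symm

theorem sum_mul_expFun_eq (hR : R ≠ 0) (ha : 1 ≤ a) (hβ : β ≤ a - 1)
    (hRr : R = 3 ^ a * r) (hr : ¬ (3 : ℤ) ∣ r) (h0 : (0 : ℤ) ∈ L) (hα : α 0 = 1)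
    (hl : ∀ l ∈ L, l ≠ 0 → l = 3 ^ (a - 1 - β) * s l)
    (hs : ∀ l ∈ L, l ≠ 0 → ¬ (3 : ℤ) ∣ s l) {q : ℤ} (hd : ∀ l ∈ L, l ≠ 0 → r ∣ q * s l) :
    ∑ l ∈ L, ((‖α l‖ ^ 2 : ℝ) : ℂ) * expFun ((l : ℝ) / R) ((3 ^ β * q : ℤ) : ℝ) =
      1 + classMass L α s 1 * cubeRoot (r * q) + classMass L α s 2 * cubeRoot (r * q) ^ 2 := by
  have hterm : ∀ l ∈ L, ((‖α l‖ ^ 2 : ℝ) : ℂ) * expFun ((l : ℝ) / R) ((3 ^ β * q : ℤ) : ℝ) =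
      (if l = 0 then 1 else 0) +
      (if l ≠ 0 ∧ s l ≡ 1 [ZMOD 3] then ((‖α l‖ ^ 2 : ℝ) : ℂ) else 0) * cubeRoot (r * q) +
      (if l ≠ 0 ∧ s l ≡ 2 [ZMOD 3] then ((‖α l‖ ^ 2 : ℝ) : ℂ) else 0) * cubeRoot (r * q) ^ 2 := by
    intro l hlL
    by_cases hl0 : l = 0
    · subst hl0
      simp [hα, expFun_zero]
    · rw [expFun_eq_cubeRoot hR ha hβ hRr hr (hl l hlL hl0) (hd l hlL hl0)]
      have h3 := hs l hlL hl0
      have hcases : s l % 3 = 1 ∨ s l % 3 = 2 := by omega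
      rcases hcases with h | h
      · have e1 : s l ≡ 1 [ZMOD 3] := h
        have e2 : ¬ s l ≡ 2 [ZMOD 3] := by simp [Int.ModEq, h]
        have e3 : cubeRoot (r * q * s l) = cubeRoot (r * q) :=
          cubeRoot_eq_iff.2 (by simpa using e1.mul_left (r * q))
        simp [hl0, e1, e2, e3]
      · have e1 : s l ≡ 2 [ZMOD 3] := h
        have e2 : ¬ s l ≡ 1 [ZMOD 3] := by simp [Int.ModEq, h]
        have e3 : cubeRoot (r * q * s l) = cubeRoot (r * q) ^ 2 := by
          rw [← cubeRoot_two_mul, cubeRoot_eq_iff, mul_comm 2]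
          exact e1.mul_left (r * q)
        simp [hl0, e1, e2, e3]
  rw [Finset.sum_congr rfl hterm, Finset.sum_add_distrib, Finset.sum_add_distrib,
    ← Finset.sum_mul, ← Finset.sum_mul, Finset.sum_ite_eq', if_pos h0, ← Finset.sum_filter,
    ← Finset.sum_filter, classMass, classMass, Complex.ofReal_sum, Complex.ofReal_sum]

end

variable {R b₁ b₂ : ℤ} {L : Finset ℤ} {α : ℤ → ℂ}

theorem card_three_digits (hb₁ : b₁ ≠ 0) (hb₂ : b₂ ≠ 0) (hb : b₁ ≠ b₂) :
    ({0, b₁, b₂} : Finset ℤ).card = 3 :=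
  Finset.card_eq_three.2 ⟨0, b₁, b₂, hb₁.symm, hb₂.symm, hb, rfl⟩

theorem ThreeDigitConditions.isIsometryCondition {a β : ℕ} {r q₁ q₂ : ℤ} {s : ℤ → ℤ}
    (h : ThreeDigitConditions R b₁ b₂ L α a r β q₁ q₂ s) (hR : R ≠ 0)
    (hb₁ : b₁ ≠ 0) (hb₂ : b₂ ≠ 0) (hb : b₁ ≠ b₂) (h0 : (0 : ℤ) ∈ L) (hα : α 0 = 1) :
    IsIsometryCondition R {0, b₁, b₂} L α := by
  have hc1 : classMass L α s 1 = 1 := h.sum_one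
  have hc2 : classMass L α s 2 = 1 := h.sum_two
  have key : ∀ {q : ℤ}, (∀ l ∈ L, l ≠ 0 → r ∣ q * s l) →
      ∑ l ∈ L, ((‖α l‖ ^ 2 : ℝ) : ℂ) * expFun ((l : ℝ) / R) ((3 ^ β * q : ℤ) : ℝ) =
        cubeRoot (r * q) ^ 2 + cubeRoot (r * q) + 1 := fun {q} hd => by
    rw [sum_mul_expFun_eq hR h.one_le_a h.β_le h.R_eq h.not_dvd_r h0 hα h.l_eq h.not_dvd_s hd,
      hc1, hc2]
    push_cast
    ring
  have hzero : ∀ {q : ℤ} (d : ℤ), d = 3 ^ β * q → ¬ (3 : ℤ) ∣ q →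
      (∀ l ∈ L, l ≠ 0 → r ∣ q * s l) →
      ∑ l ∈ L, ((‖α l‖ ^ 2 : ℝ) : ℂ) * expFun ((l : ℝ) / R) (d : ℝ) = 0 := fun {q} d hd hq hdvd => by
    rw [hd, key hdvd, cubeRoot_sq_add_self_add_one (not_three_dvd_mul h.not_dvd_r hq)]
  have hdiag : ∑ l ∈ L, ((‖α l‖ ^ 2 : ℝ) : ℂ) * expFun ((l : ℝ) / R) ((0 : ℤ) : ℝ) = 3 := by
    have := key (q := 0) fun l _ _ => by simp
    rw [mul_zero, mul_zero, cubeRoot_zero] at this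
    rw [this]
    norm_num
  have hq : ¬ (3 : ℤ) ∣ q₁ - q₂ := fun hd => h.q_incongruent (Int.modEq_iff_dvd.2 (by
    rw [← neg_sub]
    exact (dvd_neg).2 hd))
  have hq1 := h.not_dvd_q₁
  have hq2 := h.not_dvd_q₂
  have d1 := h.dvd_q₁_s
  have d2 := h.dvd_q₂_s
  have e1 := h.b₁_eq
  have e2 := h.b₂_eq
  rw [isIsometryCondition_iff (Finset.insert_nonempty _ _), card_three_digits hb₁ hb₂ hb]
  intro b hbB b' hbB'
  simp only [Finset.mem_insert, Finset.mem_singleton] at hbB hbB'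
  by_cases hbb : b = b'
  · rw [if_pos hbb, hbb, sub_self, hdiag]
    norm_num
  rw [if_neg hbb]
  have neg : ∀ {q : ℤ}, (∀ l ∈ L, l ≠ 0 → r ∣ q * s l) → ∀ l ∈ L, l ≠ 0 → r ∣ -q * s l :=
    fun h l hl hl0 => by
      rw [neg_mul]
      exact (dvd_neg).2 (h l hl hl0)
  have dd : ∀ l ∈ L, l ≠ 0 → r ∣ (q₁ - q₂) * s l := fun l hl hl0 => by
    rw [sub_mul]
    exact dvd_sub (d1 l hl hl0) (d2 l hl hl0)
  rcases hbB with rfl | rfl | rfl <;> rcases hbB' with rfl | rfl | rfl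
  · exact absurd rfl hbb
  · exact hzero (q := q₁) _ (by rw [sub_zero]; exact e1) hq1 d1
  · exact hzero (q := q₂) _ (by rw [sub_zero]; exact e2) hq2 d2
  · exact hzero (q := -q₁) _ (by rw [e1]; ring) (by rwa [dvd_neg]) (neg d1)
  · exact absurd rfl hbb
  · exact hzero (q := -(q₁ - q₂)) _ (by rw [e1, e2]; ring) (by rwa [dvd_neg]) (neg dd)
  · exact hzero (q := -q₂) _ (by rw [e2]; ring) (by rwa [dvd_neg]) (neg d2)
  · exact hzero (q := q₁ - q₂) _ (by rw [e1, e2]; ring) hq dd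
  · exact absurd rfl hbb

theorem IsIsometryCondition.one_add_expFun_add_expFun (hT : IsIsometryCondition R {0, b₁, b₂} L α)
    (hb₁ : b₁ ≠ 0) (hb₂ : b₂ ≠ 0) (hb : b₁ ≠ b₂) (h0 : (0 : ℤ) ∈ L)
    (hα : ∀ l ∈ L, α l ≠ 0) (hα0 : α 0 = 1) {l : ℤ} (hl : l ∈ L) (hl0 : l ≠ 0) :
    1 + expFun ((l : ℝ) / R) b₁ + expFun ((l : ℝ) / R) b₂ = 0 := by
  have hsum : ∀ f : ℤ → ℂ, ∑ b ∈ ({0, b₁, b₂} : Finset ℤ), f b = f 0 + f b₁ + f b₂ := fun f => by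
    rw [Finset.sum_insert (by simp [hb₁.symm, hb₂.symm]), Finset.sum_insert (by simpa using hb),
      Finset.sum_singleton, add_assoc]
  have h1 := hT.sum_norm_sq fun _ => 1
  simp only [card_three_digits hb₁ hb₂ hb, norm_one, one_pow, Finset.sum_const, mul_one,
    nsmul_eq_mul] at h1
  rw [← Finset.add_sum_erase L _ h0, hsum, hα0] at h1
  simp only [Int.cast_zero, zero_div, expFun_zero, one_mul] at h1
  have h2 : ∑ l ∈ L.erase 0, ‖∑ b ∈ ({0, b₁, b₂} : Finset ℤ), expFun ((l : ℝ) / R) b * α l‖ ^ 2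
      = 0 := by
    norm_num at h1 ⊢
    linarith
  have h3 := (Finset.sum_eq_zero_iff_of_nonneg fun _ _ => by positivity).1 h2 l
    (Finset.mem_erase.2 ⟨hl0, hl⟩)
  rw [← Finset.sum_mul, hsum, sq_eq_zero_iff, norm_eq_zero] at h3
  have h4 := (mul_eq_zero.1 h3).resolve_right (hα l hl)
  simpa [expFun] using h4

theorem exists_int_of_sq_add_self_add_one {R : ℤ} (hR : R ≠ 0) {l b : ℤ}
    (h : expFun ((l : ℝ) / R) b ^ 2 + expFun ((l : ℝ) / R) b + 1 = 0) :
    ∃ k : ℤ, 3 * (l * b) = R * k ∧ ¬ (3 : ℤ) ∣ k ∧ expFun ((l : ℝ) / R) b = cubeRoot k := by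
  set z := expFun ((l : ℝ) / R) b with hz
  have hR' : (R : ℝ) ≠ 0 := by exact_mod_cast hR
  have h3 : expFun (3 * (l * b) / R) 1 = 1 := by
    have : expFun (3 * (l * b) / R) 1 = z * z * z := by
      rw [hz, ← expFun_add_right, ← expFun_add_right]
      refine expFun_eq_of_mul_eq ?_
      ring
    rw [this]
    linear_combination (z - 1) * h
  rw [expFun, Complex.exp_eq_one_iff] at h3
  obtain ⟨k, hk⟩ := h3
  have hpi : (2 * Real.pi * Complex.I) ≠ 0 := by simp [Real.pi_ne_zero]
  have h4 : ((3 * (l * b) / R : ℝ) : ℂ) = k := by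
    refine mul_left_cancel₀ hpi ?_
    rw [Complex.ofReal_one] at hk
    linear_combination hk
  have h5 : (3 * (l * b) / R : ℝ) = k := by exact_mod_cast h4
  have hzk : z = cubeRoot k := by
    refine expFun_eq_of_mul_eq ?_
    rw [← h5]
    ring
  refine ⟨k, ?_, fun hd => ?_, hzk⟩
  · rw [div_eq_iff hR'] at h5
    have : ((3 * (l * b) : ℤ) : ℝ) = ((R * k : ℤ) : ℝ) := by
      push_cast
      linarith
    exact_mod_cast this
  · rw [hzk, cubeRoot_eq_one_iff.2 hd] at h
    norm_num at h

theorem IsIsometryCondition.exists_residues (hT : IsIsometryCondition R {0, b₁, b₂} L α)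
    (hR : R ≠ 0) (hb₁ : b₁ ≠ 0) (hb₂ : b₂ ≠ 0) (hb : b₁ ≠ b₂) (h0 : (0 : ℤ) ∈ L)
    (hα : ∀ l ∈ L, α l ≠ 0) (hα0 : α 0 = 1) {l : ℤ} (hl : l ∈ L) (hl0 : l ≠ 0) :
    ∃ k₁ k₂ : ℤ, 3 * (l * b₁) = R * k₁ ∧ 3 * (l * b₂) = R * k₂ ∧ ¬ (3 : ℤ) ∣ k₁ ∧
      ¬ (3 : ℤ) ∣ k₂ ∧ ¬ k₁ ≡ k₂ [ZMOD 3] := by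
  have h := hT.one_add_expFun_add_expFun hb₁ hb₂ hb h0 hα hα0 hl hl0
  have hz := sq_add_self_add_one_of_add_eq_neg_one (norm_expFun _ _) (norm_expFun _ _) h
  have hw := sq_add_self_add_one_of_add_eq_neg_one (norm_expFun _ _) (norm_expFun _ _)
    (show 1 + expFun ((l : ℝ) / R) b₂ + expFun ((l : ℝ) / R) b₁ = 0 by rw [← h]; ring)
  obtain ⟨k₁, h1, h1', e1⟩ := exists_int_of_sq_add_self_add_one hR hz
  obtain ⟨k₂, h2, h2', e2⟩ := exists_int_of_sq_add_self_add_one hR hw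
  refine ⟨k₁, k₂, h1, h2, h1', h2', fun hk => ?_⟩
  rw [e1, e2, cubeRoot_eq_iff.2 hk] at h
  rw [e2] at hw
  have h3 : (3 : ℂ) = 0 := by linear_combination 4 * hw - (2 * cubeRoot k₂ + 1) * h
  norm_num at h3

theorem IsIsometryCondition.exists_threeDigitConditions
    (hT : IsIsometryCondition R {0, b₁, b₂} L α)
    (hR : R ≠ 0) (hb₁ : b₁ ≠ 0) (hb₂ : b₂ ≠ 0) (hb : b₁ ≠ b₂) (h0 : (0 : ℤ) ∈ L)
    (hα : ∀ l ∈ L, α l ≠ 0) (hα0 : α 0 = 1) :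
    ∃ (a : ℕ) (r : ℤ) (β : ℕ) (q₁ q₂ : ℤ) (s : ℤ → ℤ),
      ThreeDigitConditions R b₁ b₂ L α a r β q₁ q₂ s := by
  have hent := (isIsometryCondition_iff (Finset.insert_nonempty _ _)).1 hT
  rw [card_three_digits hb₁ hb₂ hb] at hent
  have hdiag := hent 0 (by simp) 0 (by simp)
  have hoff := hent 0 (by simp) b₁ (by simp)
  rw [if_neg hb₁.symm, sub_zero] at hoff
  rw [if_pos rfl, sub_zero] at hdiag
  obtain ⟨l₀, hl₀, hl₀0⟩ : ∃ l ∈ L, l ≠ 0 := by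
    by_contra! hL
    rw [Finset.sum_eq_single_of_mem 0 h0 fun l hl hl0 => absurd (hL l hl) hl0, hα0] at hdiag
    simp [expFun] at hdiag
  obtain ⟨a, r, hRr, hr⟩ := exists_eq_three_pow_mul hR
  obtain ⟨β, q₁, hq₁, hq₁3⟩ := exists_eq_three_pow_mul hb₁
  obtain ⟨β', q₂, hq₂, hq₂3⟩ := exists_eq_three_pow_mul hb₂
  have hdec : ∀ l : ℤ, ∃ (k : ℕ) (m : ℤ), l ≠ 0 → l = 3 ^ k * m ∧ ¬ (3 : ℤ) ∣ m := fun l => by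
    by_cases hl : l = 0
    · exact ⟨0, 0, fun h => absurd hl h⟩
    · obtain ⟨k, m, h⟩ := exists_eq_three_pow_mul hl
      exact ⟨k, m, fun _ => h⟩
  choose γ s hγ using hdec
  have hres : ∀ l ∈ L, l ≠ 0 → γ l + β + 1 = a ∧ γ l + β' + 1 = a ∧
      ∃ k₁ k₂ : ℤ, s l * q₁ = r * k₁ ∧ s l * q₂ = r * k₂ ∧ ¬ k₁ ≡ k₂ [ZMOD 3] := by
    intro l hl hl0
    obtain ⟨k₁, k₂, h1, h2, h1', h2', hk⟩ := hT.exists_residues hR hb₁ hb₂ hb h0 hα hα0 hl hl0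
    obtain ⟨hls, hs⟩ := hγ l hl0
    have e1 : 3 ^ (γ l + β + 1) * (s l * q₁) = 3 ^ a * (r * k₁) := by
      have : 3 * (3 ^ γ l * s l * (3 ^ β * q₁)) = 3 ^ a * r * k₁ := by rw [← hls, ← hq₁, ← hRr, h1]
      linear_combination this
    have e2 : 3 ^ (γ l + β' + 1) * (s l * q₂) = 3 ^ a * (r * k₂) := by
      have : 3 * (3 ^ γ l * s l * (3 ^ β' * q₂)) = 3 ^ a * r * k₂ := by
        rw [← hls, ← hq₂, ← hRr, h2]
      linear_combination this
    obtain ⟨f1, g1⟩ := three_pow_mul_inj (not_three_dvd_mul hs hq₁3) (not_three_dvd_mul hr h1') e1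
    obtain ⟨f2, g2⟩ := three_pow_mul_inj (not_three_dvd_mul hs hq₂3) (not_three_dvd_mul hr h2') e2
    exact ⟨f1, f2, k₁, k₂, g1, g2, hk⟩
  obtain ⟨f1, f2, k₁, k₂, g1, g2, hk⟩ := hres l₀ hl₀ hl₀0
  obtain rfl : β = β' := by omega
  have ha : 1 ≤ a := by omega
  have hβ : β ≤ a - 1 := by omega
  have hleq : ∀ l ∈ L, l ≠ 0 → l = 3 ^ (a - 1 - β) * s l := fun l hl hl0 => by
    have h1 := (hres l hl hl0).1
    have h2 : a - 1 - β = γ l := by omega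
    rw [h2]
    exact (hγ l hl0).1
  have hs3 : ∀ l ∈ L, l ≠ 0 → ¬ (3 : ℤ) ∣ s l := fun l _ hl0 => (hγ l hl0).2
  have hd1 : ∀ l ∈ L, l ≠ 0 → r ∣ q₁ * s l := fun l hl hl0 => by
    obtain ⟨-, -, k, -, h, -, -⟩ := hres l hl hl0
    exact ⟨k, by rw [mul_comm, h]⟩
  have hd2 : ∀ l ∈ L, l ≠ 0 → r ∣ q₂ * s l := fun l hl hl0 => by
    obtain ⟨-, -, -, k, -, h, -⟩ := hres l hl hl0
    exact ⟨k, by rw [mul_comm, h]⟩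
  rw [hq₁, sum_mul_expFun_eq hR ha hβ hRr hr h0 hα0 hleq hs3 hd1] at hoff
  have hdiag' := sum_mul_expFun_eq (q := 0) hR ha hβ hRr hr h0 hα0 hleq hs3 (by simp)
  rw [mul_zero, mul_zero, hdiag, cubeRoot_zero] at hdiag'
  have hz := cubeRoot_sq_add_self_add_one (not_three_dvd_mul hr hq₁3)
  set z := cubeRoot (r * q₁)
  set S₁ := classMass L α s 1 with hS₁
  set S₂ := classMass L α s 2 with hS₂
  have htot : S₁ + S₂ = 2 := by
    have : (S₁ : ℂ) + S₂ = 2 := by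
      push_cast at hdiag'
      linear_combination -hdiag'
    exact_mod_cast this
  have hlin : ((S₁ - S₂ : ℝ) : ℂ) * z = ((S₂ - 1 : ℝ) : ℂ) := by
    push_cast
    linear_combination hoff - S₂ * hz
  have hquad : (S₂ - 1) ^ 2 + (S₂ - 1) * (S₁ - S₂) + (S₁ - S₂) ^ 2 = 0 := by
    have : (((S₂ - 1) ^ 2 + (S₂ - 1) * (S₁ - S₂) + (S₁ - S₂) ^ 2 : ℝ) : ℂ) = 0 := by
      push_cast at hlin ⊢
      linear_combination ((S₁ : ℂ) - S₂) ^ 2 * hz -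
        (((S₁ : ℂ) - S₂) * z + (S₂ - 1) + (S₁ - S₂)) * hlin
    exact_mod_cast this
  have hS₂1 : S₂ = 1 := by
    have : (S₂ - 1) ^ 2 = 0 := by
      have h1 : S₁ = 2 - S₂ := by linarith
      rw [h1] at hquad
      linarith
    have := pow_eq_zero_iff (two_ne_zero) |>.1 this
    linarith
  refine ⟨a, r, β, q₁, q₂, s, ha, hRr, hr, hβ, hq₁, hq₂, hq₁3, hq₂3, fun hq => hk ?_, hleq, hs3,
    hd1, hd2, by show S₁ = 1; linarith, hS₂1⟩
  have h1 : r * k₁ ≡ r * k₂ [ZMOD 3] := by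
    rw [← g1, ← g2]
    exact hq.mul_left _
  rw [Int.modEq_iff_dvd, ← mul_sub] at h1
  exact Int.modEq_iff_dvd.2 ((Int.prime_three.dvd_or_dvd h1).resolve_left hr)

theorem ThreeDigitConditions.mask_congr {a β : ℕ} {r q₁ q₂ : ℤ} {s : ℤ → ℤ}
    (h : ThreeDigitConditions R b₁ b₂ L α a r β q₁ q₂ s) (hR : R ≠ 0) {l l' : ℤ}
    (hl : l ∈ L) (hl' : l' ∈ L) (hl0 : l ≠ 0) (hl0' : l' ≠ 0) (hs : s l ≡ s l' [ZMOD 3]) (t : ℝ) :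
    mask {0, b₁, b₂} ((t - l) / R) = mask {0, b₁, b₂} ((t - l') / R) := by
  rw [mask, mask]
  congr 1
  refine Finset.sum_congr rfl fun b hb => ?_
  have hsub : ∀ m : ℤ, expFun ((t - m) / R) b = expFun (t / R) b *
      starRingEnd ℂ (expFun ((m : ℝ) / R) b) := fun m => by
    rw [conj_expFun, ← expFun_add_left]
    congr 1
    ring
  rw [hsub, hsub]
  have key : ∀ q : ℤ, (∀ l ∈ L, l ≠ 0 → r ∣ q * s l) → b = 3 ^ β * q →
      expFun ((l : ℝ) / R) b = expFun ((l' : ℝ) / R) b := fun q hd hbq => by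
    rw [hbq, expFun_eq_cubeRoot hR h.one_le_a h.β_le h.R_eq h.not_dvd_r (h.l_eq l hl hl0)
      (hd l hl hl0), expFun_eq_cubeRoot hR h.one_le_a h.β_le h.R_eq h.not_dvd_r
      (h.l_eq l' hl' hl0') (hd l' hl' hl0'), cubeRoot_eq_iff]
    exact hs.mul_left _
  simp only [Finset.mem_insert, Finset.mem_singleton] at hb
  rcases hb with hb | hb | hb
  · rw [key 0 (by simp) (by simp [hb])]
  · rw [key q₁ h.dvd_q₁_s (by rw [hb, ← h.b₁_eq])]
  · rw [key q₂ h.dvd_q₂_s (by rw [hb, ← h.b₂_eq])]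

theorem ThreeDigitConditions.isParsevalFrame {a β : ℕ} {r q₁ q₂ : ℤ} {s : ℤ → ℤ}
    (h : ThreeDigitConditions R b₁ b₂ L α a r β q₁ q₂ s) (hinc : HasIncongruentPairs R L s)
    (hR : 2 ≤ |R|) (hb₁ : b₁ ≠ 0) (hb₂ : b₂ ≠ 0) (hb : b₁ ≠ b₂) (h0 : (0 : ℤ) ∈ L)
    (hα : ∀ l ∈ L, α l ≠ 0) (hα0 : α 0 = 1) :
    IsParsevalFrame (weightedExponentials (selfAffineMeasure R {0, b₁, b₂}) R L α) := by
  have hR0 : R ≠ 0 := by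
    rintro rfl
    simp at hR
  refine isParsevalFrame_weightedExponentials hR
    (isSelfAffine_selfAffineMeasure hR (Finset.insert_nonempty _ _)) h0 hα0
    (h.isIsometryCondition hR0 hb₁ hb₂ hb h0 hα0) fun t l hl hl0 hne => ?_
  obtain ⟨l₁, m₁, l₁', m₁', l₂, m₂, l₂', m₂', n₁, n₁', n₂, n₂', c₁, c₁', c₂, c₂', i₁, i₂⟩ := hinc
  have hmask := right_ne_zero_of_mul hne
  have hmove : ∀ l' ∈ L, l' ≠ 0 → s l ≡ s l' [ZMOD 3] →
      α l' * mask {0, b₁, b₂} ((t - l') / R) ≠ 0 := fun l' hl' hl0' hs =>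
    mul_ne_zero (hα l' hl') (h.mask_congr hR0 hl hl' hl0 hl0' hs t ▸ hmask)
  have h3 := h.not_dvd_s l hl hl0
  have hcases : s l % 3 = 1 ∨ s l % 3 = 2 := by omega
  rcases hcases with hs | hs
  · have hs' : s l ≡ 1 [ZMOD 3] := hs
    exact ⟨l₁, m₁, l₁', m₁', hmove l₁ m₁ n₁ (hs'.trans c₁.symm),
      hmove l₁' m₁' n₁' (hs'.trans c₁'.symm), i₁⟩
  · have hs' : s l ≡ 2 [ZMOD 3] := hs
    exact ⟨l₂, m₂, l₂', m₂', hmove l₂ m₂ n₂ (hs'.trans c₂.symm),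
      hmove l₂' m₂' n₂' (hs'.trans c₂'.symm), i₂⟩

end

end WeightedFourier

theorem theorem5p10 (R b₁ b₂ : ℤ) (hR : 2 ≤ |R|)
    (hb₁ : b₁ ≠ 0) (hb₂ : b₂ ≠ 0) (hb : b₁ ≠ b₂)
    (L : Finset ℤ) (h0 : (0 : ℤ) ∈ L)
    (α : ℤ → ℂ) (hα : ∀ l ∈ L, α l ≠ 0) (hα0 : α 0 = 1) :
    (WeightedFourier.IsIsometryCondition R {0, b₁, b₂} L α ↔
      ∃ (a : ℕ) (r : ℤ) (β : ℕ) (q₁ q₂ : ℤ) (s : ℤ → ℤ),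
        WeightedFourier.ThreeDigitConditions R b₁ b₂ L α a r β q₁ q₂ s) ∧
    (∀ (a : ℕ) (r : ℤ) (β : ℕ) (q₁ q₂ : ℤ) (s : ℤ → ℤ),
      WeightedFourier.ThreeDigitConditions R b₁ b₂ L α a r β q₁ q₂ s →
      WeightedFourier.HasIncongruentPairs R L s →
      WeightedFourier.IsParsevalFrame
        (WeightedFourier.weightedExponentials
          (WeightedFourier.selfAffineMeasure R {0, b₁, b₂}) R L α)) := by
  have hR0 : R ≠ 0 := by
    rintro rfl
    simp at hR
  refine ⟨⟨fun hT => hT.exists_threeDigitConditions hR0 hb₁ hb₂ hb h0 hα hα0, ?_⟩,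
    fun a r β q₁ q₂ s h hinc => h.isParsevalFrame hinc hR hb₁ hb₂ hb h0 hα hα0⟩
  rintro ⟨a, r, β, q₁, q₂, s, h⟩
  exact h.isIsometryCondition hR0 hb₁ hb₂ hb h0 hα0
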